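/- Let $\Bbbk$ be a field and $Q$ a quiver (loops and multiple arrows allowed). The path coalgebra $\Bbbk Q$ has the paths of $Q$ as a basis, with $\Delta(p)=\sum_{xy=p}x\otimes y$ (first $x$, then $y$), and with $\varepsilon(p)=1$ if $p$ is trivial and $\varepsilon(p)=0$ otherwise. Let $C\subseteq \Bbbk Q$ be a subcoalgebra. *Tail closure.* A multipath is a linear combination of paths that all have the same source and all have the same target; a nonzero multipath $p$ has a target $t(p)$. A finite set $F$ of multipaths in $C$ is called independent if it is linearly independent and, for every $x\in F$, the smallest right coideal of $C$ containing $x$ meets $F$ only in $x$. Let $\overline Q$ be obtained from $Q$ by adding, for each finite independent set $F$ of multipaths in $C$, a new vertex $e_F$ and, for each $p\in F$, a new arrow $\alpha_{p,F}:t(p)\to e_F$. Put $q_F=\sum_{p\in F}p\,\alpha_{p,F}\in\Bbbk\overline Q$, and let $\overline C$ be the subcoalgebra of $\Bbbk\overline Q$ generated by $C$ and all the $q_F$. Put $T^0(C)=C$, $T^{n+1}(C)=\overline{T^n(C)}$ and $T(C)=\bigcup_n T^n(C)$. This is a subcoalgebra of the path coalgebra of the union of the quivers so obtained. *Notions.*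 A coalgebra $D$ is *left semiperfect* if the injective envelope of every simple right $D$-comodule is finite dimensional. It *generates its category of left comodules* if every left $D$-comodule $X$ admits an epimorphism $D^{(I)}\to X$ of left comodules for some set $I$. Let $D^*$ be the dual algebra, with product $(fg)(c)=\sum f(c_1)g(c_2)$. Then $D$ is *left quasi-coFrobenius* (left qcF) if $D$, as a left $D^*$-module via $f\rightharpoonup c=\sum c_1f(c_2)$, embeds in a free left $D^*$-module. **Statement.** 1. If $C$ is not left semiperfect, then $T(C)$ generates its category of left comodules, $T(C)$ is not left semiperfect, and $T(C)$ is not left qcF. 2. Let $A_\infty$ be the quiver with vertices $x_1,x_2,\dots$ and exactly one arrow $x_n\to x_{n+1}$ for each $n\ge 1$ (and no other arrows). Over every field $\Bbbk$, the coalgebra $\Bbbk A_\infty$ is not left semiperfect; hence $T(\Bbbk A_\infty)$ generates its category of left comodules but is neither left semiperfect nor left qcF. 3. In particular, over every field there is a coalgebra that generates its category of left comodules but is not left qcF: the question whether every coalgebra $D$ that generates its category of left comodules is left qcF has a negative answer. -/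

import Mathlib

open scoped TensorProduct

universe u

/-! ## Subcoalgebras -/

section Subcoalgebra

variable (k : Type u) [Field k] {A : Type u} [AddCommGroup A] [Module k A]

theorem tensor_subtype_injective (D : Submodule k A) :
    Function.Injective (TensorProduct.map D.subtype D.subtype) := by
  apply TensorProduct.map_injective_of_flat_flat <;> exact D.injective_subtype

variable {k} in
/-- A tensor all of whose slices lie in `D` lies in `D ⊗ D`. -/
theorem mem_range_of_slices (D : Submodule k A) (t : A ⊗[k] A)
    (h1 : ∀ f : A →ₗ[k] k, TensorProduct.lid k A (f.rTensor A t) ∈ D)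
    (h2 : ∀ f : A →ₗ[k] k, TensorProduct.rid k A (f.lTensor A t) ∈ D) :
    t ∈ LinearMap.range (TensorProduct.map D.subtype D.subtype) := by
  classical
  obtain ⟨q, hq⟩ := D.exists_isCompl
  set π : A →ₗ[k] D := D.projectionOnto q hq
  have hπ : ∀ x ∈ D, D.subtype (π x) = x := fun x hx =>
    congrArg Subtype.val (Submodule.projectionOnto_apply_left hq ⟨x, hx⟩)
  let b := Module.Basis.ofVectorSpace k A
  have r1 : (D.subtype ∘ₗ π).lTensor A t = t := by
    apply (TensorProduct.equivFinsuppOfBasisLeft b).injective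
    ext i
    rw [TensorProduct.equivFinsuppOfBasisLeft_apply, TensorProduct.equivFinsuppOfBasisLeft_apply]
    have e : ∀ s : A ⊗[k] A, TensorProduct.lid k A ((b.coord i).rTensor A
        ((D.subtype ∘ₗ π).lTensor A s)) =
        D.subtype (π (TensorProduct.lid k A ((b.coord i).rTensor A s))) := by
      intro s
      induction s with
      | zero => simp
      | tmul a b => simp
      | add a b ha hb => simp only [map_add, ha, hb]
    rw [e, hπ _ (h1 _)]
  have r2 : (D.subtype ∘ₗ π).rTensor A t = t := by
    apply (TensorProduct.equivFinsuppOfBasisRight b).injective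
    ext i
    rw [TensorProduct.equivFinsuppOfBasisRight_apply, TensorProduct.equivFinsuppOfBasisRight_apply]
    have e : ∀ s : A ⊗[k] A, TensorProduct.rid k A ((b.coord i).lTensor A
        ((D.subtype ∘ₗ π).rTensor A s)) =
        D.subtype (π (TensorProduct.rid k A ((b.coord i).lTensor A s))) := by
      intro s
      induction s with
      | zero => simp
      | tmul a b => simp
      | add a b ha hb => simp only [map_add, ha, hb]
    rw [e, hπ _ (h2 _)]
  refine ⟨TensorProduct.map π π t, ?_⟩
  conv_rhs => rw [← r2, ← r1]
  rw [← LinearMap.comp_apply, ← LinearMap.comp_apply, ← TensorProduct.map_comp,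
    LinearMap.rTensor_comp_lTensor]

variable [Coalgebra k A]

/-- `D` is a subcoalgebra of `A`: a linear subspace with `Δ(D) ⊆ D ⊗ D`. -/
def IsSubcoalgebra (D : Submodule k A) : Prop :=
  ∀ x ∈ D, (Coalgebra.comul x : A ⊗[k] A) ∈
    LinearMap.range (TensorProduct.map D.subtype D.subtype)

variable {k}

/-- The comultiplication of `A`, restricted to a subcoalgebra. -/
noncomputable def IsSubcoalgebra.comul {D : Submodule k A} (hD : IsSubcoalgebra k D) :
    D →ₗ[k] D ⊗[k] D :=
  (LinearEquiv.ofInjective _ (tensor_subtype_injective k D)).symm.toLinearMap ∘ₗ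
    ((Coalgebra.comul : A →ₗ[k] A ⊗[k] A) ∘ₗ D.subtype).codRestrict _ (fun x => hD x x.2)

theorem IsSubcoalgebra.map_comul {D : Submodule k A} (hD : IsSubcoalgebra k D) :
    TensorProduct.map D.subtype D.subtype ∘ₗ hD.comul =
      (Coalgebra.comul : A →ₗ[k] A ⊗[k] A) ∘ₗ D.subtype := by
  ext x
  have h := LinearEquiv.apply_symm_apply
    (LinearEquiv.ofInjective _ (tensor_subtype_injective k D))
    (((Coalgebra.comul : A →ₗ[k] A ⊗[k] A) ∘ₗ D.subtype).codRestrict _ (fun x => hD x x.2) x)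
  exact congrArg Subtype.val h

variable (k A) in
/-- The subcoalgebras of a coalgebra. -/
structure Subcoalgebra where
  /-- the underlying subspace -/
  carrier : Submodule k A
  isSubcoalgebra : IsSubcoalgebra k carrier

/-- A subcoalgebra is a coalgebra, with the restricted structure. -/
noncomputable instance (C : Subcoalgebra k A) : Coalgebra k C.carrier where
  comul := C.isSubcoalgebra.comul
  counit := Coalgebra.counit ∘ₗ C.carrier.subtype
  coassoc := by
    set D := C.carrier
    set i := D.subtype
    have hi : Function.Injective i := D.injective_subtype
    have h := C.isSubcoalgebra.map_comul
    have hinj : Function.Injective (TensorProduct.map i (TensorProduct.map i i)) :=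
      TensorProduct.map_injective_of_flat_flat _ _ hi (tensor_subtype_injective k D)
    have key : TensorProduct.map i (TensorProduct.map i i) ∘ₗ
        (TensorProduct.assoc k D D D ∘ₗ C.isSubcoalgebra.comul.rTensor D ∘ₗ C.isSubcoalgebra.comul)
        = TensorProduct.map i (TensorProduct.map i i) ∘ₗ
        (C.isSubcoalgebra.comul.lTensor D ∘ₗ C.isSubcoalgebra.comul) := by
      have e1 : TensorProduct.map i (TensorProduct.map i i) ∘ₗ
          (TensorProduct.assoc k D D D).toLinearMap =
          (TensorProduct.assoc k A A A).toLinearMap ∘ₗ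
            TensorProduct.map (TensorProduct.map i i) i := by
        ext; rfl
      have e2 : TensorProduct.map (TensorProduct.map i i) i ∘ₗ
          C.isSubcoalgebra.comul.rTensor D =
          (Coalgebra.comul (R := k) (A := A)).rTensor A ∘ₗ TensorProduct.map i i := by
        ext x y
        exact congrArg (· ⊗ₜ[k] (y : A)) (LinearMap.congr_fun h x)
      have e3 : TensorProduct.map i (TensorProduct.map i i) ∘ₗ
          C.isSubcoalgebra.comul.lTensor D =
          (Coalgebra.comul (R := k) (A := A)).lTensor A ∘ₗ TensorProduct.map i i := by
        ext x y
        exact congrArg ((x : A) ⊗ₜ[k] ·) (LinearMap.congr_fun h y)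
      calc _ = (TensorProduct.map i (TensorProduct.map i i) ∘ₗ
              (TensorProduct.assoc k D D D).toLinearMap) ∘ₗ
              C.isSubcoalgebra.comul.rTensor D ∘ₗ C.isSubcoalgebra.comul := rfl
        _ = (TensorProduct.assoc k A A A).toLinearMap ∘ₗ
              (TensorProduct.map (TensorProduct.map i i) i ∘ₗ
                C.isSubcoalgebra.comul.rTensor D) ∘ₗ C.isSubcoalgebra.comul := by rw [e1]; rfl
        _ = (TensorProduct.assoc k A A A).toLinearMap ∘ₗ
              (Coalgebra.comul (R := k) (A := A)).rTensor A ∘ₗ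
              (TensorProduct.map i i ∘ₗ C.isSubcoalgebra.comul) := by rw [e2]; rfl
        _ = ((TensorProduct.assoc k A A A).toLinearMap ∘ₗ
              (Coalgebra.comul (R := k) (A := A)).rTensor A ∘ₗ Coalgebra.comul) ∘ₗ i := by
            rw [h]; rfl
        _ = (Coalgebra.comul (R := k) (A := A)).lTensor A ∘ₗ
              (TensorProduct.map i i ∘ₗ C.isSubcoalgebra.comul) := by
            rw [Coalgebra.coassoc, h]; rfl
        _ = (TensorProduct.map i (TensorProduct.map i i) ∘ₗ
              C.isSubcoalgebra.comul.lTensor D) ∘ₗ C.isSubcoalgebra.comul := by rw [e3]; rfl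
    ext x
    exact hinj (LinearMap.congr_fun key x)
  rTensor_counit_comp_comul := by
    set D := C.carrier
    set i := D.subtype
    have hi : Function.Injective i := D.injective_subtype
    have h := C.isSubcoalgebra.map_comul
    have hinj : Function.Injective (i.lTensor k) := Module.Flat.lTensor_preserves_injective_linearMap _ hi
    ext x
    apply hinj
    have e : i.lTensor k ∘ₗ (Coalgebra.counit ∘ₗ i).rTensor D =
        (Coalgebra.counit (R := k) (A := A)).rTensor A ∘ₗ TensorProduct.map i i := by
      ext; rfl
    have := LinearMap.congr_fun e (C.isSubcoalgebra.comul x)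
    simp only [LinearMap.comp_apply] at this ⊢
    rw [this]
    have h2 := LinearMap.congr_fun h x
    simp only [LinearMap.comp_apply] at h2
    rw [h2]
    simp [i]
  lTensor_counit_comp_comul := by
    set D := C.carrier
    set i := D.subtype
    have hi : Function.Injective i := D.injective_subtype
    have h := C.isSubcoalgebra.map_comul
    have hinj : Function.Injective (i.rTensor k) := Module.Flat.rTensor_preserves_injective_linearMap _ hi
    ext x
    apply hinj
    have e : i.rTensor k ∘ₗ (Coalgebra.counit ∘ₗ i).lTensor D =
        (Coalgebra.counit (R := k) (A := A)).lTensor A ∘ₗ TensorProduct.map i i := by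
      ext; rfl
    have := LinearMap.congr_fun e (C.isSubcoalgebra.comul x)
    simp only [LinearMap.comp_apply] at this ⊢
    rw [this]
    have h2 := LinearMap.congr_fun h x
    simp only [LinearMap.comp_apply] at h2
    rw [h2]
    simp [i]

/-- Slices of `Δ x` on the right lie in a subcoalgebra containing `x`. -/
theorem IsSubcoalgebra.slice_right {D : Submodule k A} (hD : IsSubcoalgebra k D)
    (f : A →ₗ[k] k) {x : A} (hx : x ∈ D) :
    TensorProduct.lid k A (f.rTensor A (Coalgebra.comul x)) ∈ D := by
  obtain ⟨t, ht⟩ := hD x hx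
  rw [← ht]
  clear ht
  induction t with
  | zero => simp
  | tmul a b => simpa using D.smul_mem _ b.2
  | add a b ha hb => simp only [map_add]; exact D.add_mem (ha) (hb)

/-- Slices of `Δ x` on the left lie in a subcoalgebra containing `x`. -/
theorem IsSubcoalgebra.slice_left {D : Submodule k A} (hD : IsSubcoalgebra k D)
    (f : A →ₗ[k] k) {x : A} (hx : x ∈ D) :
    TensorProduct.rid k A (f.lTensor A (Coalgebra.comul x)) ∈ D := by
  obtain ⟨t, ht⟩ := hD x hx
  rw [← ht]
  clear ht
  induction t with
  | zero => simp
  | tmul a b => simpa using D.smul_mem _ a.2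
  | add a b ha hb => simp only [map_add]; exact D.add_mem (ha) (hb)

/-- The subcoalgebra generated by a subset `S`: the smallest subcoalgebra that contains `S`. -/
noncomputable def Subcoalgebra.closure (S : Set A) : Subcoalgebra k A where
  carrier := sInf {D : Submodule k A | IsSubcoalgebra k D ∧ S ⊆ D}
  isSubcoalgebra := by
    intro x hx
    refine mem_range_of_slices _ _ (fun f => ?_) (fun f => ?_) <;>
      rw [Submodule.mem_sInf] at hx ⊢ <;> intro D hD
    · exact hD.1.slice_right f (hx D hD)
    · exact hD.1.slice_left f (hx D hD)

/-- A (possibly infinite) sum of subcoalgebras is a subcoalgebra. -/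
theorem IsSubcoalgebra.iSup {ι : Type*} {D : ι → Submodule k A}
    (hD : ∀ i, IsSubcoalgebra k (D i)) : IsSubcoalgebra k (⨆ i, D i) := by
  intro x hx
  induction hx using Submodule.iSup_induction' with
  | mem i x hx =>
    obtain ⟨t, ht⟩ := hD i x hx
    refine ⟨TensorProduct.map (Submodule.inclusion (le_iSup D i))
      (Submodule.inclusion (le_iSup D i)) t, ?_⟩
    rw [← ht, ← LinearMap.comp_apply, ← TensorProduct.map_comp]
    rfl
  | zero => simp
  | add x y _ _ hx hy => rw [map_add]; exact Submodule.add_mem _ hx hy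

/-- The image of a subcoalgebra under a linear map that commutes with `Δ` is a subcoalgebra. -/
theorem IsSubcoalgebra.map {B : Type u} [AddCommGroup B] [Module k B] [Coalgebra k B]
    {D : Submodule k A} (hD : IsSubcoalgebra k D) (f : A →ₗ[k] B)
    (hf : TensorProduct.map f f ∘ₗ Coalgebra.comul = Coalgebra.comul ∘ₗ f) :
    IsSubcoalgebra k (D.map f) := by
  rintro _ ⟨x, hx, rfl⟩
  obtain ⟨t, ht⟩ := hD x hx
  refine ⟨TensorProduct.map (f.submoduleMap D) (f.submoduleMap D) t, ?_⟩
  have e : (Coalgebra.comul (f x) : B ⊗[k] B) = TensorProduct.map f f (Coalgebra.comul x) :=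
    (LinearMap.congr_fun hf x).symm
  rw [e, ← ht, ← LinearMap.comp_apply, ← LinearMap.comp_apply, ← TensorProduct.map_comp,
    ← TensorProduct.map_comp]
  rfl

end Subcoalgebra

/-! ## Comodules -/

section Comodules

variable (k : Type u) [Field k] (C : Type u) [AddCommGroup C] [Module k C] [Coalgebra k C]

/-- A right `C`-comodule structure `ρ : M → M ⊗ C` on the vector space `M`. -/
class RightComodule (M : Type u) [AddCommGroup M] [Module k M] where
  /-- the coaction -/
  coact : M →ₗ[k] M ⊗[k] C
  coassoc : TensorProduct.assoc k M C C ∘ₗ coact.rTensor C ∘ₗ coact =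
    (Coalgebra.comul (R := k) (A := C)).lTensor M ∘ₗ coact
  counit_coact : (Coalgebra.counit (R := k) (A := C)).lTensor M ∘ₗ coact =
    (TensorProduct.mk k M k).flip 1

/-- A left `C`-comodule structure `ρ : M → C ⊗ M` on the vector space `M`. -/
class LeftComodule (M : Type u) [AddCommGroup M] [Module k M] where
  /-- the coaction -/
  coact : M →ₗ[k] C ⊗[k] M
  coassoc : TensorProduct.assoc k C C M ∘ₗ
    (Coalgebra.comul (R := k) (A := C)).rTensor M ∘ₗ coact = coact.lTensor C ∘ₗ coact
  counit_coact : (Coalgebra.counit (R := k) (A := C)).rTensor M ∘ₗ coact =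
    TensorProduct.mk k k M 1

namespace RightComodule

variable {M N : Type u} [AddCommGroup M] [Module k M] [RightComodule k C M]
  [AddCommGroup N] [Module k N] [RightComodule k C N]

/-- A linear map of right comodules that commutes with the coactions. -/
def IsHom (f : M →ₗ[k] N) : Prop :=
  coact ∘ₗ f = f.rTensor C ∘ₗ coact (C := C)

/-- A subcomodule: `ρ(P) ⊆ P ⊗ C`. -/
def IsSubcomodule (P : Submodule k M) : Prop :=
  ∀ x ∈ P, (coact x : M ⊗[k] C) ∈ LinearMap.range (P.subtype.rTensor C)

variable (M) in
/-- A simple right comodule: nonzero, with no subcomodules but zero and itself. -/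
def IsSimple : Prop :=
  Nontrivial M ∧ ∀ P : Submodule k M, IsSubcomodule k C P → P = ⊥ ∨ P = ⊤

variable (M) in
/-- An injective right comodule: homomorphisms into `M` extend along injective homomorphisms. -/
def IsInjective : Prop :=
  ∀ (X Y : Type u) [AddCommGroup X] [Module k X] [RightComodule k C X]
    [AddCommGroup Y] [Module k Y] [RightComodule k C Y] (i : X →ₗ[k] Y) (f : X →ₗ[k] M),
    IsHom k C i → Function.Injective i → IsHom k C f →
      ∃ g : Y →ₗ[k] M, IsHom k C g ∧ g ∘ₗ i = f

/-- `j : M → N` is an injective envelope of `M`: an injective homomorphism into an injective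
comodule whose image meets every nonzero subcomodule nontrivially. -/
def IsInjectiveEnvelope (j : M →ₗ[k] N) : Prop :=
  IsInjective k C N ∧ IsHom k C j ∧ Function.Injective j ∧
    ∀ P : Submodule k N, IsSubcomodule k C P → P ≠ ⊥ → P ⊓ LinearMap.range j ≠ ⊥

end RightComodule

/-- `C` is left semiperfect: the injective envelope of every simple right `C`-comodule is
finite dimensional. -/
def LeftSemiperfect : Prop :=
  ∀ (S E : Type u) [AddCommGroup S] [Module k S] [RightComodule k C S]
    [AddCommGroup E] [Module k E] [RightComodule k C E] (j : S →ₗ[k] E),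
    RightComodule.IsSimple k C S → RightComodule.IsInjectiveEnvelope k C j →
      FiniteDimensional k E

/-- An object of the category of left `C`-comodules. -/
structure LeftComod where
  /-- the underlying vector space -/
  carrier : Type u
  [addCommGroup : AddCommGroup carrier]
  [module : Module k carrier]
  [comodule : LeftComodule k C carrier]

namespace LeftComod

attribute [instance] addCommGroup module comodule

variable {k C}

/-- Morphisms of left comodules: linear maps that commute with the coactions. -/
@[ext]
structure Hom (M N : LeftComod k C) where
  /-- the underlying linear map -/
  toLinearMap : M.carrier →ₗ[k] N.carrier
  comm : LeftComodule.coact ∘ₗ toLinearMap =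
    toLinearMap.lTensor C ∘ₗ LeftComodule.coact (C := C)

/-- The category of left `C`-comodules. -/
instance : CategoryTheory.Category.{u} (LeftComod k C) where
  Hom := Hom
  id M := ⟨LinearMap.id, by simp⟩
  comp f g := ⟨g.toLinearMap ∘ₗ f.toLinearMap, by
    rw [← LinearMap.comp_assoc, g.comm, LinearMap.comp_assoc, f.comm, ← LinearMap.comp_assoc,
      LinearMap.lTensor_comp]⟩
  id_comp _ := rfl
  comp_id _ := rfl
  assoc _ _ _ := rfl

variable (k C) in
/-- `C` as a left comodule over itself, by `Δ`. -/
def regular : LeftComod k C where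
  carrier := C
  comodule :=
    { coact := Coalgebra.comul
      coassoc := Coalgebra.coassoc
      counit_coact := Coalgebra.rTensor_counit_comp_comul }

end LeftComod

/-- `G` is a generator: every object `X` admits an epimorphism from a coproduct of copies
of `G`. -/
def IsGeneratorObject {𝒞 : Type*} [CategoryTheory.Category.{u} 𝒞] (G : 𝒞) : Prop :=
  ∀ X : 𝒞, ∃ (I : Type u) (c : CategoryTheory.Limits.Cofan (fun _ : I => G)) (φ : c.pt ⟶ X),
    Nonempty (CategoryTheory.Limits.IsColimit c) ∧ CategoryTheory.Epi φ

/-- `C` generates its category of left comodules. -/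
def GeneratesLeftComodules : Prop := IsGeneratorObject (LeftComod.regular k C)

/-- The dual algebra `C*`, with the convolution product `(f * g)(c) = ∑ f(c₁) g(c₂)`. -/
abbrev DualAlgebra : Type u := WithConv (C →ₗ[k] k)

variable {k C} in
/-- The action `f ⇀ c = ∑ c₁ f(c₂)` of `C*` on `C`. -/
noncomputable def hit (f : DualAlgebra k C) : C →ₗ[k] C :=
  (TensorProduct.rid k C).toLinearMap ∘ₗ f.ofConv.lTensor C ∘ₗ Coalgebra.comul

/-- `C` as a left `C*`-module. -/
@[reducible]
noncomputable def leftDualModule : Module (DualAlgebra k C) C where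
  smul f c := hit f c
  one_smul c := by
    change TensorProduct.rid k C ((Coalgebra.counit (R := k)).lTensor C (Coalgebra.comul c)) = c
    simp
  mul_smul f g c := by
    change hit (f * g) c = hit f (hit g c)
    have e1 : ∀ t : C ⊗[k] C, Coalgebra.comul (TensorProduct.rid k C (g.ofConv.lTensor C t)) =
        TensorProduct.rid k (C ⊗[k] C)
          (g.ofConv.lTensor (C ⊗[k] C) ((Coalgebra.comul (R := k)).rTensor C t)) := by
      intro t
      induction t with
      | zero => simp
      | tmul a b => simp
      | add a b ha hb => simp only [map_add, ha, hb]
    have e2 : ∀ t : (C ⊗[k] C) ⊗[k] C, TensorProduct.rid k C (f.ofConv.lTensor C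
        (TensorProduct.rid k (C ⊗[k] C) (g.ofConv.lTensor (C ⊗[k] C) t))) =
        TensorProduct.rid k C ((LinearMap.mul' k k ∘ₗ TensorProduct.map f.ofConv g.ofConv).lTensor C
          (TensorProduct.assoc k C C C t)) := by
      intro t
      induction t with
      | zero => simp
      | add a b ha hb => simp only [map_add, ha, hb]
      | tmul s c =>
        induction s with
        | zero => simp
        | tmul a b => simp [smul_smul, mul_comm]
        | add a b ha hb => simp only [TensorProduct.add_tmul, map_add, ha, hb]
    simp only [hit, LinearMap.comp_apply, LinearEquiv.coe_coe]
    rw [e1, e2, Coalgebra.coassoc_apply, LinearMap.convMul_def]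
    simp only [LinearMap.lTensor_comp, LinearMap.comp_apply]
  smul_zero f := map_zero (hit f)
  smul_add f := map_add (hit f)
  add_smul f g c := by
    change TensorProduct.rid k C ((f.ofConv + g.ofConv).lTensor C (Coalgebra.comul c)) =
      TensorProduct.rid k C (f.ofConv.lTensor C (Coalgebra.comul c)) +
      TensorProduct.rid k C (g.ofConv.lTensor C (Coalgebra.comul c))
    simp [LinearMap.lTensor_add]
  zero_smul c := by
    change TensorProduct.rid k C ((0 : C →ₗ[k] k).lTensor C (Coalgebra.comul c)) = 0
    simp

/-- `C` is left quasi-coFrobenius: as a left `C*`-module it embeds in a free left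
`C*`-module. -/
def LeftQuasiCoFrobenius : Prop :=
  letI := leftDualModule k C
  ∃ (ι : Type u) (F : C →ₗ[DualAlgebra k C] (ι →₀ DualAlgebra k C)), Function.Injective F

end Comodules

/-! ## Path coalgebras -/

section PathCoalgebra

/-- A path in a quiver, with arbitrary source and target. -/
@[ext]
structure AnyPath (V : Type u) [Quiver.{u} V] where
  /-- the source -/
  src : V
  /-- the target -/
  tgt : V
  /-- the path -/
  path : Quiver.Path src tgt

namespace Quiver.Path

variable {V : Type u} [Quiver.{u} V]

/-- All factorizations `p = x y` of a path. -/
def factorizations {a : V} : {c : V} → Path a c → List (Σ b : V, Path a b × Path b c)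
  | _, nil => [⟨a, nil, nil⟩]
  | _, cons p e => ⟨_, cons p e, nil⟩ :: (factorizations p).map fun s => ⟨s.1, s.2.1, s.2.2.cons e⟩

theorem mem_factorizations {a b c : V} (p : Path a c) (x : Path a b) (y : Path b c) :
    (⟨b, x, y⟩ : Σ b : V, Path a b × Path b c) ∈ factorizations p ↔ x.comp y = p := by
  induction p with
  | nil =>
    simp only [factorizations, List.mem_singleton]
    constructor
    · rintro ⟨⟩
      rfl
    · cases y with
      | nil =>
        rintro h
        cases h
        rfl
      | cons y e => exact fun h => absurd h (cons_ne_nil _ _)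
  | cons p e ih =>
    simp only [factorizations, List.mem_cons, List.mem_map]
    constructor
    · rintro (h | ⟨⟨b', x', y'⟩, h, h'⟩)
      · cases h
        rfl
      · cases h'
        rw [comp_cons, (ih _).1 h]
    · cases y with
      | nil =>
        rintro h
        cases h
        exact Or.inl rfl
      | cons y e' =>
        intro h
        rw [comp_cons] at h
        cases h
        exact Or.inr ⟨⟨b, x, y⟩, (ih y).2 rfl, rfl⟩

theorem nodup_factorizations {a c : V} (p : Path a c) : (factorizations p).Nodup := by
  induction p with
  | nil => simp [factorizations]
  | cons p e ih =>
    rw [factorizations, List.nodup_cons]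
    refine ⟨?_, ih.map ?_⟩
    · intro h
      obtain ⟨⟨b, x, y⟩, -, h⟩ := List.mem_map.1 h
      have h1 : b = _ := congrArg Sigma.fst h
      subst h1
      have h2 := congrArg Prod.snd (eq_of_heq (Sigma.mk.inj h).2)
      exact cons_ne_nil _ _ h2
    · rintro ⟨b, x, y⟩ ⟨b', x', y'⟩ h
      obtain ⟨h1, h2⟩ := Sigma.mk.inj h
      dsimp only at h1
      subst h1
      have h3 := eq_of_heq h2
      have h4 : x = x' := congrArg Prod.fst h3
      have h5 := congrArg Prod.snd h3
      cases h4
      cases h5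
      rfl

/-- Summing over triple factorizations in either order gives the same result. -/
theorem sum_factorizations_assoc {a : V} {M : Type*} [AddCommMonoid M] : {d : V} →
    (p : Path a d) → (f : ∀ b c : V, Path a b → Path b c → Path c d → M) →
    ((factorizations p).map fun s =>
      ((factorizations s.2.1).map fun r => f r.1 s.1 r.2.1 r.2.2 s.2.2).sum).sum =
    ((factorizations p).map fun s =>
      ((factorizations s.2.2).map fun r => f s.1 r.1 s.2.1 r.2.1 r.2.2).sum).sum
  | _, nil, f => by simp [factorizations]
  | _, cons p e, f => by
    have ih := sum_factorizations_assoc p (fun b c x y z => f b c x y (z.cons e))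
    simp only [factorizations, List.map_cons, List.map_map, List.sum_cons, Function.comp_def,
      List.sum_map_add, ih, List.map_nil, List.sum_nil]
    abel

end Quiver.Path

variable (k : Type u) [Field k] (V : Type u) [Quiver.{u} V]

/-- The underlying vector space of the path coalgebra: linear combinations of paths. -/
def PathCoalgebra : Type u := AnyPath V →₀ k

noncomputable instance : AddCommGroup (PathCoalgebra k V) :=
  inferInstanceAs (AddCommGroup (AnyPath V →₀ k))

noncomputable instance : Module k (PathCoalgebra k V) :=
  inferInstanceAs (Module k (AnyPath V →₀ k))

namespace PathCoalgebra

variable {V}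

/-- A path, as an element of the path coalgebra. -/
noncomputable def of {a b : V} (p : Quiver.Path a b) : PathCoalgebra k V :=
  Finsupp.single (⟨a, b, p⟩ : AnyPath V) (1 : k)

variable {k}

/-- The set of paths that occur in a linear combination. -/
def support (x : PathCoalgebra k V) : Finset (AnyPath V) := Finsupp.support x

variable (k) in
/-- The linear map with prescribed values on paths. -/
noncomputable def lift {M : Type*} [AddCommGroup M] [Module k M]
    (f : ∀ {a b : V}, Quiver.Path a b → M) : PathCoalgebra k V →ₗ[k] M :=
  Finsupp.linearCombination k fun p : AnyPath V => f p.path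

theorem lift_of {M : Type*} [AddCommGroup M] [Module k M]
    (f : ∀ {a b : V}, Quiver.Path a b → M) {a b : V} (p : Quiver.Path a b) :
    lift k f (of k p) = f p := by
  unfold lift of
  exact (Finsupp.linearCombination_single k 1 _).trans (one_smul k _)

theorem hom_ext {M : Type*} [AddCommGroup M] [Module k M] {f g : PathCoalgebra k V →ₗ[k] M}
    (h : ∀ {a b : V} (p : Quiver.Path a b), f (of k p) = g (of k p)) : f = g :=
  Finsupp.lhom_ext' fun p => LinearMap.ext_ring (h p.path)

/-- The path coalgebra: `Δ(p) = ∑_{xy = p} x ⊗ y`, and `ε(p)` is `1` if `p` is trivial and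
`0` otherwise. -/
noncomputable instance : CoalgebraStruct k (PathCoalgebra k V) where
  comul := lift k fun p => (p.factorizations.map fun s => of k s.2.1 ⊗ₜ[k] of k s.2.2).sum
  counit := lift k fun p => if p.length = 0 then 1 else 0

theorem comul_of {a b : V} (p : Quiver.Path a b) :
    (Coalgebra.comul (of k p) : PathCoalgebra k V ⊗[k] PathCoalgebra k V) =
      (p.factorizations.map fun s => of k s.2.1 ⊗ₜ[k] of k s.2.2).sum :=
  lift_of _ p

theorem counit_of {a b : V} (p : Quiver.Path a b) :
    Coalgebra.counit (of k p) = if p.length = 0 then (1 : k) else 0 :=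
  lift_of _ p

theorem sum_counit_left {M : Type*} [AddCommGroup M] [Module k M] {a : V} : {c : V} →
    (p : Quiver.Path a c) → (f : ∀ b : V, Quiver.Path b c → M) →
    (p.factorizations.map fun s =>
      (if s.2.1.length = 0 then (1 : k) else 0) • f s.1 s.2.2).sum = f a p
  | _, .nil, f => by simp [Quiver.Path.factorizations]
  | _, .cons p e, f => by
    have := sum_counit_left p (fun b y => f b (y.cons e))
    simpa [Quiver.Path.factorizations, Function.comp_def] using this

theorem sum_counit_right {M : Type*} [AddCommGroup M] [Module k M] {a c : V}
    (p : Quiver.Path a c) (f : ∀ b : V, Quiver.Path a b → M) :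
    (p.factorizations.map fun s =>
      (if s.2.2.length = 0 then (1 : k) else 0) • f s.1 s.2.1).sum = f c p := by
  cases p with
  | nil => simp [Quiver.Path.factorizations]
  | cons p e => simp [Quiver.Path.factorizations, Function.comp_def]

noncomputable instance : Coalgebra k (PathCoalgebra k V) where
  coassoc := by
    refine hom_ext fun {a d} p => ?_
    have h := Quiver.Path.sum_factorizations_assoc p
      (fun b c x y z => of k x ⊗ₜ[k] (of k y ⊗ₜ[k] of k z))
    simp only [LinearMap.comp_apply, comul_of, map_list_sum, List.map_map, Function.comp_def,
      LinearMap.rTensor_tmul, LinearMap.lTensor_tmul, LinearEquiv.coe_coe]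
    have e1 : ∀ (s : Σ b : V, Quiver.Path a b × Quiver.Path b d),
        TensorProduct.assoc k (PathCoalgebra k V) (PathCoalgebra k V) (PathCoalgebra k V)
          ((s.2.1.factorizations.map fun r => of k r.2.1 ⊗ₜ[k] of k r.2.2).sum ⊗ₜ[k] of k s.2.2) =
        (s.2.1.factorizations.map fun r =>
          of k r.2.1 ⊗ₜ[k] (of k r.2.2 ⊗ₜ[k] of k s.2.2)).sum := fun s => by
      rw [← TensorProduct.mk_apply, ← LinearMap.flip_apply, map_list_sum, map_list_sum,
        List.map_map, List.map_map]
      rfl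
    have e2 : ∀ (s : Σ b : V, Quiver.Path a b × Quiver.Path b d),
        of k s.2.1 ⊗ₜ[k] (s.2.2.factorizations.map fun r => of k r.2.1 ⊗ₜ[k] of k r.2.2).sum =
        (s.2.2.factorizations.map fun r =>
          of k s.2.1 ⊗ₜ[k] (of k r.2.1 ⊗ₜ[k] of k r.2.2)).sum := fun s => by
      rw [← TensorProduct.mk_apply, map_list_sum, List.map_map]
      rfl
    simp only [e1, e2]
    exact h
  rTensor_counit_comp_comul := by
    refine hom_ext fun {a d} p => ?_
    have h := sum_counit_left (k := k) p (fun b y => (1 : k) ⊗ₜ[k] of k y)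
    simp only [LinearMap.comp_apply, comul_of, map_list_sum, List.map_map, Function.comp_def,
      LinearMap.rTensor_tmul, counit_of]
    rw [TensorProduct.mk_apply, ← h]
    simp only [TensorProduct.smul_tmul', smul_eq_mul, mul_one]
  lTensor_counit_comp_comul := by
    refine hom_ext fun {a d} p => ?_
    have h := sum_counit_right (k := k) p (fun b y => of k y ⊗ₜ[k] (1 : k))
    simp only [LinearMap.comp_apply, comul_of, map_list_sum, List.map_map, Function.comp_def,
      LinearMap.lTensor_tmul, counit_of]
    rw [LinearMap.flip_apply, TensorProduct.mk_apply, ← h]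
    simp only [← TensorProduct.tmul_smul, smul_eq_mul, mul_one]

end PathCoalgebra

end PathCoalgebra

/-! ## The tail closure -/

section PushForward

variable {k : Type u} [Field k] {V W : Type u} [Quiver.{u} V] [Quiver.{u} W]

theorem Quiver.Path.factorizations_mapPath (φ : Prefunctor V W) {a c : V} (p : Quiver.Path a c) :
    (φ.mapPath p).factorizations = p.factorizations.map fun s =>
      (⟨φ.obj s.1, φ.mapPath s.2.1, φ.mapPath s.2.2⟩ :
        Σ b : W, Quiver.Path (φ.obj a) b × Quiver.Path b (φ.obj c)) := by
  induction p with
  | nil => simp [factorizations]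
  | cons p e ih => simp [factorizations, ih, Function.comp_def]

namespace PathCoalgebra

/-- The linear map between path coalgebras induced by a morphism of quivers. -/
noncomputable def pushForward (φ : Prefunctor V W) : PathCoalgebra k V →ₗ[k] PathCoalgebra k W :=
  lift k fun p => of k (φ.mapPath p)

theorem pushForward_comul (φ : Prefunctor V W) :
    TensorProduct.map (pushForward (k := k) φ) (pushForward φ) ∘ₗ Coalgebra.comul =
      Coalgebra.comul ∘ₗ pushForward φ := by
  refine hom_ext fun {a d} p => ?_
  simp only [LinearMap.comp_apply, comul_of, pushForward, lift_of, map_list_sum, List.map_map,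
    Function.comp_def, TensorProduct.map_tmul, Quiver.Path.factorizations_mapPath]

end PathCoalgebra

end PushForward

section TailClosure

variable {k : Type u} [Field k]

section RightCoideals

variable {A : Type u} [AddCommGroup A] [Module k A] [Coalgebra k A]

/-- `I` is a right coideal of the subcoalgebra `C`, that is, a right subcomodule of `C`:
a subspace with `Δ(I) ⊆ I ⊗ C`. -/
def IsRightCoideal (C : Subcoalgebra k A) (I : Submodule k A) : Prop :=
  I ≤ C.carrier ∧ ∀ x ∈ I, (Coalgebra.comul x : A ⊗[k] A) ∈
    LinearMap.range (TensorProduct.map I.subtype C.carrier.subtype)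

/-- The right coideal of `C` generated by `x`: the smallest one that contains `x`. -/
def rightCoidealGenerated (C : Subcoalgebra k A) (x : A) : Submodule k A :=
  sInf {I : Submodule k A | IsRightCoideal C I ∧ x ∈ I}

end RightCoideals

variable {V : Type u} [Quiver.{u} V]

/-- A multipath: a linear combination of paths that share their source and their target. -/
def IsMultipath (x : PathCoalgebra k V) : Prop :=
  ∃ a b : V, ∀ p ∈ x.support, p.src = a ∧ p.tgt = b

/-- All paths that occur in `x` have target `v`. -/
def EndsAt (x : PathCoalgebra k V) (v : V) : Prop := ∀ p ∈ x.support, p.tgt = v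

/-- A finite independent set of multipaths in `C`: it is linearly independent, and the right
coideal generated by any `x` in it meets it in `x` only. -/
structure IndependentSet (C : Subcoalgebra k (PathCoalgebra k V)) where
  /-- the elements -/
  elems : Finset (PathCoalgebra k V)
  mem_coalgebra : ∀ x ∈ elems, x ∈ C.carrier
  isMultipath : ∀ x ∈ elems, IsMultipath x
  linearIndependent : LinearIndependent k (fun x : elems => (x : PathCoalgebra k V))
  independent : ∀ x ∈ elems,
    (rightCoidealGenerated C x : Set (PathCoalgebra k V)) ∩ elems = {x}

/-- The vertices of the extended quiver: those of `Q`, and a new vertex `e_F` for each finite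
independent set `F` of multipaths in `C`. -/
inductive TailVertex (C : Subcoalgebra k (PathCoalgebra k V)) : Type u
  | old (v : V)
  | new (F : IndependentSet C)

/-- The arrows of the extended quiver: those of `Q`, and one arrow `α_{p,F}` from `t(p)` to `e_F`
for each element `p` of `F`.
As `p` is a nonzero multipath, there is exactly one vertex `a` at which it ends. -/
def TailVertex.Arrow {C : Subcoalgebra k (PathCoalgebra k V)} :
    TailVertex C → TailVertex C → Type u
  | old a, old b => a ⟶ b
  | old a, new F => {p : F.elems // EndsAt (p : PathCoalgebra k V) a}
  | new _, _ => PEmpty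

instance (C : Subcoalgebra k (PathCoalgebra k V)) : Quiver.{u} (TailVertex C) where
  Hom := TailVertex.Arrow

/-- The inclusion of `Q` into the extended quiver. -/
def TailVertex.inclusion (C : Subcoalgebra k (PathCoalgebra k V)) :
    Prefunctor V (TailVertex C) where
  obj := old
  map e := e

open Classical in
/-- The element `p α_{p,F}` of the path coalgebra of the extended quiver, for `p` in `F`. -/
noncomputable def IndependentSet.tailTerm {C : Subcoalgebra k (PathCoalgebra k V)}
    (F : IndependentSet C) (p : F.elems) : PathCoalgebra k (TailVertex C) :=
  PathCoalgebra.lift k (fun {a b} (q : Quiver.Path a b) =>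
    if h : EndsAt (p : PathCoalgebra k V) b then
      PathCoalgebra.of k ((show Quiver.Path (TailVertex.old a) (TailVertex.old b) from
        (TailVertex.inclusion C).mapPath q).cons (c := TailVertex.new F) ⟨p, h⟩)
    else 0) (p : PathCoalgebra k V)

/-- The multipath `q_F = ∑_{p ∈ F} p α_{p,F}`. -/
noncomputable def IndependentSet.tail {C : Subcoalgebra k (PathCoalgebra k V)}
    (F : IndependentSet C) : PathCoalgebra k (TailVertex C) :=
  ∑ p : F.elems, F.tailTerm p

/-- The subcoalgebra of the path coalgebra of the extended quiver that is generated by `C` and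
all the `q_F`. -/
noncomputable def tailExtension (C : Subcoalgebra k (PathCoalgebra k V)) :
    Subcoalgebra k (PathCoalgebra k (TailVertex C)) :=
  Subcoalgebra.closure
    (PathCoalgebra.pushForward (TailVertex.inclusion C) '' C.carrier ∪
      Set.range fun F : IndependentSet C => F.tail)

variable (k) in
/-- A quiver with a subcoalgebra of its path coalgebra. -/
structure QuiverCoalgebra where
  /-- the vertices -/
  vertices : Type u
  [quiver : Quiver.{u} vertices]
  /-- the subcoalgebra -/
  coalgebra : Subcoalgebra k (PathCoalgebra k vertices)

attribute [instance] QuiverCoalgebra.quiver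

/-- The sequence `T⁰(C) = C`, `Tⁿ⁺¹(C)` the extension of `Tⁿ(C)`, with the quivers `Tⁿ(Q)`. -/
noncomputable def tailStage (C : Subcoalgebra k (PathCoalgebra k V)) : ℕ → QuiverCoalgebra k
  | 0 => ⟨V, C⟩
  | n + 1 => ⟨TailVertex (tailStage C n).coalgebra, tailExtension (tailStage C n).coalgebra⟩

/-- The vertices of the union `T(Q)` of the increasing sequence of quivers `Tⁿ(Q)`: those of `Q`,
and those that are added in passing from `Tⁿ(Q)` to `Tⁿ⁺¹(Q)`, for each `n`. -/
inductive TailClosureVertex (C : Subcoalgebra k (PathCoalgebra k V)) : Type u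
  | base (v : V)
  | new (n : ℕ) (F : IndependentSet (tailStage C n).coalgebra)

namespace TailClosureVertex

variable {C : Subcoalgebra k (PathCoalgebra k V)}

variable (C) in
/-- The inclusion of the vertices of `Tⁿ(Q)` into those of `T(Q)`. -/
noncomputable def ofStage : (n : ℕ) → (tailStage C n).vertices → TailClosureVertex C
  | 0 => fun v => base v
  | n + 1 => fun x : TailVertex (tailStage C n).coalgebra =>
    match x with
    | .old v => ofStage n v
    | .new F => new n F

/-- The arrows of `T(Q)`: those of `Q`, and, for each `n` and each finite independent set `F` of
multipaths in `Tⁿ(C)`, one arrow from `t(p)` to `e_F` for each element `p` of `F`. -/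
def Arrow (x : TailClosureVertex C) : TailClosureVertex C → Type u
  | base b =>
    match x with
    | base a => a ⟶ b
    | new _ _ => PEmpty
  | new n F => {p : F.elems // ∃ v : (tailStage C n).vertices, ofStage C n v = x ∧
      EndsAt (p : PathCoalgebra k (tailStage C n).vertices) v}

instance : Quiver.{u} (TailClosureVertex C) where
  Hom := Arrow

variable (C) in
/-- The inclusion of the arrows of `Tⁿ(Q)` into those of `T(Q)`. -/
noncomputable def ofStageArrow : (n : ℕ) → {x y : (tailStage C n).vertices} → (x ⟶ y) →
    (ofStage C n x ⟶ ofStage C n y)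
  | 0, _, _, e => e
  | n + 1, x, y, e =>
    match (generalizing := true) (x : TailVertex (tailStage C n).coalgebra),
      (y : TailVertex (tailStage C n).coalgebra), e with
    | .old _, .old _, e => ofStageArrow n e
    | .old a, .new _, e => ⟨e.1, a, rfl, e.2⟩

variable (C) in
/-- The inclusion of `Tⁿ(Q)` into `T(Q)`. -/
noncomputable def stageInclusion (n : ℕ) :
    Prefunctor (tailStage C n).vertices (TailClosureVertex C) where
  obj := ofStage C n
  map := ofStageArrow C n

end TailClosureVertex

/-- The tail closure `T(C) = ⋃ₙ Tⁿ(C)`, a subcoalgebra of the path coalgebra of `T(Q)`. -/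
noncomputable def tailClosure (C : Subcoalgebra k (PathCoalgebra k V)) :
    Subcoalgebra k (PathCoalgebra k (TailClosureVertex C)) where
  carrier := ⨆ n : ℕ, (tailStage C n).coalgebra.carrier.map
    (PathCoalgebra.pushForward (TailClosureVertex.stageInclusion C n))
  isSubcoalgebra := IsSubcoalgebra.iSup fun n =>
    (tailStage C n).coalgebra.isSubcoalgebra.map _ (PathCoalgebra.pushForward_comul _)

end TailClosure

/-! ## The quiver `A_∞` -/

/-- The vertices `0, 1, 2, …` of the quiver `A_∞`. -/
structure AInfinity : Type u where
  /-- the number of the vertex -/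
  index : ℕ

/-- The quiver `A_∞`, with exactly one arrow from `n` to `n + 1` for every `n`. -/
instance : Quiver.{u} AInfinity.{u} where
  Hom a b := ULift (PLift (b.index = a.index + 1))

/-- The full path coalgebra, as a subcoalgebra of itself. -/
def Subcoalgebra.full (k : Type u) [Field k] (A : Type u) [AddCommGroup A] [Module k A]
    [Coalgebra k A] : Subcoalgebra k A where
  carrier := ⊤
  isSubcoalgebra x _ := by
    have h : Function.Surjective (⊤ : Submodule k A).subtype := fun a => ⟨⟨a, trivial⟩, rfl⟩
    rw [LinearMap.range_eq_top.2 (TensorProduct.map_surjective h h)]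
    trivial

/-! Put `f ⇀ x = ∑ x₁ f(x₂)` and `x ↼ f = ∑ f(x₁) x₂`, which make a coalgebra `D` a bimodule over
its dual algebra. For `D` inside a path coalgebra, let `e_a` be the coefficient of the trivial path
at `a`. Then `D ↼ e_a` consists of the elements of `D` supported on paths with source `a`, and `D`,
as a right comodule, is the direct sum of these pieces.

Generation. Let `X` be a left comodule over `D = T(C)`. Each `x` in `X` is a finite sum of elements
`y = x · e_a`, and the coefficients of such a `y` span a finite dimensional right coideal `M` inside
`D ↼ e_a`. This `M` lies in some stage `Tⁿ(C)`, and a generating set of multipaths of minimal size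
is an independent set `F` of that stage (`exists_independentSet_generates`). Every `p` in `F` has
the form `g ⇀ q_F`, so `q_F ↼ f = 0` forces `f` to vanish on `M`, whence `y · f = 0`. Thus `q_F ↼ f
↦ y · f` is well defined. Conversely, all elements of `T(C)` that end at `e_F` have the form `q_F ↼
f` (`exists_sliceRight_vertexCoeff_eq`), so projecting to the paths that end at `e_F` is a left
comodule map from `D` to `q_F ↼ D*` that fixes `q_F`. The composite `D → X` sends `q_F` to `y`
(`generatesLeftComodules_of_pieces`).

Failure of finiteness. As a summand of `D`, the right comodule `D ↼ e_a` is injective. Acting by the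
coefficient of a longest path cuts any nonzero element of it down to the trivial path at `a`, so it
is an essential extension of a one-dimensional comodule. If it is infinite dimensional, `D` is not
left semiperfect. It is not left qcF either: a coordinate of an embedding into a free module that is
nonzero on the trivial path would have to satisfy infinitely many independent conditions at finitely
many elements of `D`. Conversely, if every `D ↼ e_a` is finite dimensional, then `D` is left
semiperfect, because the envelope of a simple comodule embeds in one of them. So a `C` that is not
left semiperfect has an infinite dimensional piece, and this piece survives in `T(C)`. -/

/-! ### The two actions of functionals on a coalgebra -/

section Slices

variable {k : Type u} [Field k] {A : Type u} [AddCommGroup A] [Module k A] [Coalgebra k A]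

/-- The action `f ⇀ x = ∑ x₁ f(x₂)` of functionals on a coalgebra. -/
noncomputable def sliceRight (f : A →ₗ[k] k) : A →ₗ[k] A :=
  (TensorProduct.rid k A).toLinearMap ∘ₗ f.lTensor A ∘ₗ Coalgebra.comul

/-- The action `x ↼ f = ∑ f(x₁) x₂` of functionals on a coalgebra. -/
noncomputable def sliceLeft (f : A →ₗ[k] k) : A →ₗ[k] A :=
  (TensorProduct.lid k A).toLinearMap ∘ₗ f.rTensor A ∘ₗ Coalgebra.comul

theorem sliceRight_apply (f : A →ₗ[k] k) (x : A) :
    sliceRight f x = TensorProduct.rid k A (f.lTensor A (Coalgebra.comul x)) := rfl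

theorem sliceLeft_apply (f : A →ₗ[k] k) (x : A) :
    sliceLeft f x = TensorProduct.lid k A (f.rTensor A (Coalgebra.comul x)) := rfl

theorem sliceRight_counit (x : A) : sliceRight (Coalgebra.counit (R := k)) x = x := by
  simp [sliceRight_apply]

theorem sliceLeft_counit (x : A) : sliceLeft (Coalgebra.counit (R := k)) x = x := by
  simp [sliceLeft_apply]

/-- Both sides are `∑ f(x₁) g(x₂)`. This adjunction turns identities for `⇀` into identities for `↼`
after testing against functionals. -/
theorem apply_sliceRight (f g : A →ₗ[k] k) (x : A) : f (sliceRight g x) = g (sliceLeft f x) := by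
  rw [sliceRight_apply, sliceLeft_apply]
  induction (Coalgebra.comul x : A ⊗[k] A) with
  | zero => simp
  | tmul a b => simp [mul_comm]
  | add a b ha hb => simp only [map_add, ha, hb]

theorem counit_sliceLeft (f : A →ₗ[k] k) (x : A) :
    Coalgebra.counit (sliceLeft f x) = f x := by
  rw [← apply_sliceRight, sliceRight_counit]

/-- `Δ(x ↼ f) = ∑ (x₁ ↼ f) ⊗ x₂`. -/
theorem comul_sliceLeft (f : A →ₗ[k] k) :
    Coalgebra.comul ∘ₗ sliceLeft f = (sliceLeft f).rTensor A ∘ₗ Coalgebra.comul := by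
  have e1 : (Coalgebra.comul (R := k) (A := A)) ∘ₗ (TensorProduct.lid k A).toLinearMap ∘ₗ
      f.rTensor A = (TensorProduct.lid k (A ⊗[k] A)).toLinearMap ∘ₗ f.rTensor (A ⊗[k] A) ∘ₗ
        (Coalgebra.comul (R := k)).lTensor A := by
    ext; simp
  have e2 : (TensorProduct.lid k (A ⊗[k] A)).toLinearMap ∘ₗ f.rTensor (A ⊗[k] A) ∘ₗ
      (TensorProduct.assoc k A A A).toLinearMap =
      ((TensorProduct.lid k A).toLinearMap ∘ₗ f.rTensor A).rTensor A := by
    ext; simp [TensorProduct.smul_tmul']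
  calc _ = ((Coalgebra.comul (R := k) (A := A)) ∘ₗ (TensorProduct.lid k A).toLinearMap ∘ₗ
        f.rTensor A) ∘ₗ Coalgebra.comul := rfl
    _ = (TensorProduct.lid k (A ⊗[k] A)).toLinearMap ∘ₗ f.rTensor (A ⊗[k] A) ∘ₗ
        ((Coalgebra.comul (R := k)).lTensor A ∘ₗ Coalgebra.comul) := by rw [e1]; rfl
    _ = ((TensorProduct.lid k (A ⊗[k] A)).toLinearMap ∘ₗ f.rTensor (A ⊗[k] A) ∘ₗ
        (TensorProduct.assoc k A A A).toLinearMap) ∘ₗ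
          (Coalgebra.comul (R := k)).rTensor A ∘ₗ Coalgebra.comul := by
        rw [← Coalgebra.coassoc]; rfl
    _ = _ := by
        rw [e2, ← LinearMap.comp_assoc, ← LinearMap.rTensor_comp]; rfl

/-- By coassociativity both sides are `∑ f(x₁) x₂ g(x₃)`. -/
theorem sliceRight_sliceLeft (f g : A →ₗ[k] k) (x : A) :
    sliceRight g (sliceLeft f x) = sliceLeft f (sliceRight g x) := by
  have h := LinearMap.congr_fun (comul_sliceLeft f) x
  simp only [LinearMap.comp_apply] at h
  rw [sliceRight_apply, h, sliceRight_apply]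
  induction (Coalgebra.comul x : A ⊗[k] A) with
  | zero => simp
  | tmul a b => simp
  | add a b ha hb => simp only [map_add, ha, hb]

/-- The functional `g ∘ₗ sliceLeft f` is the convolution product `f * g`, so this is the axiom of a
right module. -/
theorem sliceLeft_sliceLeft (f g : A →ₗ[k] k) (x : A) :
    sliceLeft g (sliceLeft f x) = sliceLeft (g ∘ₗ sliceLeft f) x := by
  have h := LinearMap.congr_fun (comul_sliceLeft f) x
  simp only [LinearMap.comp_apply] at h
  rw [sliceLeft_apply, h, sliceLeft_apply, LinearMap.rTensor_comp, LinearMap.comp_apply]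

/-- Here `f ∘ₗ sliceLeft g` is the convolution product `g * f`. Functionals separate points, and
under the adjunction `apply_sliceRight` the claim becomes the commutation of the two actions. -/
theorem sliceRight_sliceRight (f g : A →ₗ[k] k) (x : A) :
    sliceRight g (sliceRight f x) = sliceRight (f ∘ₗ sliceLeft g) x := by
  rw [← sub_eq_zero, ← Module.forall_dual_apply_eq_zero_iff k]
  intro l
  rw [map_sub, sub_eq_zero, apply_sliceRight, apply_sliceRight, ← sliceRight_sliceLeft,
    apply_sliceRight, LinearMap.comp_apply]

/-- `f ↦ x ↼ f`, as a linear map. -/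
noncomputable def leftOrbit (x : A) : (A →ₗ[k] k) →ₗ[k] A where
  toFun f := sliceLeft f x
  map_add' f g := by simp [sliceLeft_apply, LinearMap.rTensor_add]
  map_smul' c f := by simp [sliceLeft_apply, LinearMap.rTensor_smul]

theorem leftOrbit_apply (x : A) (f : A →ₗ[k] k) : leftOrbit x f = sliceLeft f x := rfl

/-- A subspace that is closed under `f ⇀ ·` and `· ↼ f` is a subcoalgebra. -/
theorem isSubcoalgebra_of_slices {D : Submodule k A}
    (hR : ∀ f : A →ₗ[k] k, ∀ x ∈ D, sliceRight f x ∈ D)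
    (hL : ∀ f : A →ₗ[k] k, ∀ x ∈ D, sliceLeft f x ∈ D) : IsSubcoalgebra k D := fun x hx =>
  mem_range_of_slices D _ (fun f => hL f x hx) (fun f => hR f x hx)

theorem IsSubcoalgebra.sliceRight_mem {D : Submodule k A} (hD : IsSubcoalgebra k D)
    (f : A →ₗ[k] k) {x : A} (hx : x ∈ D) : sliceRight f x ∈ D := hD.slice_left f hx

theorem IsSubcoalgebra.sliceLeft_mem {D : Submodule k A} (hD : IsSubcoalgebra k D)
    (f : A →ₗ[k] k) {x : A} (hx : x ∈ D) : sliceLeft f x ∈ D := hD.slice_right f hx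

theorem coe_sliceRight (D : Subcoalgebra k A) (f : A →ₗ[k] k) (x : D.carrier) :
    (sliceRight (f ∘ₗ D.carrier.subtype) x : A) = sliceRight f (x : A) := by
  have h : TensorProduct.map D.carrier.subtype D.carrier.subtype (Coalgebra.comul x) =
      Coalgebra.comul (x : A) := LinearMap.congr_fun D.isSubcoalgebra.map_comul x
  rw [sliceRight_apply, sliceRight_apply, ← h]
  induction (Coalgebra.comul x : D.carrier ⊗[k] D.carrier) with
  | zero => simp
  | tmul a b => simp
  | add a b ha hb => simp only [map_add, ← ha, ← hb, Submodule.coe_add]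

theorem coe_sliceLeft (D : Subcoalgebra k A) (f : A →ₗ[k] k) (x : D.carrier) :
    (sliceLeft (f ∘ₗ D.carrier.subtype) x : A) = sliceLeft f (x : A) := by
  have h : TensorProduct.map D.carrier.subtype D.carrier.subtype (Coalgebra.comul x) =
      Coalgebra.comul (x : A) := LinearMap.congr_fun D.isSubcoalgebra.map_comul x
  rw [sliceLeft_apply, sliceLeft_apply, ← h]
  induction (Coalgebra.comul x : D.carrier ⊗[k] D.carrier) with
  | zero => simp
  | tmul a b => simp
  | add a b ha hb => simp only [map_add, ← ha, ← hb, Submodule.coe_add]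

section Morphism

variable {B : Type u} [AddCommGroup B] [Module k B] [Coalgebra k B]

theorem sliceRight_map (φ : A →ₗ[k] B)
    (hφ : TensorProduct.map φ φ ∘ₗ Coalgebra.comul = Coalgebra.comul ∘ₗ φ) (f : B →ₗ[k] k) (x : A) :
    sliceRight f (φ x) = φ (sliceRight (f ∘ₗ φ) x) := by
  have h := LinearMap.congr_fun hφ x
  simp only [LinearMap.comp_apply] at h
  rw [sliceRight_apply, ← h, sliceRight_apply]
  induction (Coalgebra.comul x : A ⊗[k] A) with
  | zero => simp
  | tmul a b => simp
  | add a b ha hb => simp only [map_add, ha, hb]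

theorem sliceLeft_map (φ : A →ₗ[k] B)
    (hφ : TensorProduct.map φ φ ∘ₗ Coalgebra.comul = Coalgebra.comul ∘ₗ φ) (f : B →ₗ[k] k) (x : A) :
    sliceLeft f (φ x) = φ (sliceLeft (f ∘ₗ φ) x) := by
  have h := LinearMap.congr_fun hφ x
  simp only [LinearMap.comp_apply] at h
  rw [sliceLeft_apply, ← h, sliceLeft_apply]
  induction (Coalgebra.comul x : A ⊗[k] A) with
  | zero => simp
  | tmul a b => simp
  | add a b ha hb => simp only [map_add, ha, hb]

end Morphism

end Slices

/-- Functionals on the left factor separate the elements of a tensor product. -/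
theorem TensorProduct.eq_of_forall_functional_left {k D X : Type*} [Field k] [AddCommGroup D]
    [Module k D] [AddCommGroup X] [Module k X]
    {s t : D ⊗[k] X} (h : ∀ f : D →ₗ[k] k,
      TensorProduct.lid k X (f.rTensor X s) = TensorProduct.lid k X (f.rTensor X t)) : s = t := by
  classical
  let b := Module.Basis.ofVectorSpace k D
  apply (TensorProduct.equivFinsuppOfBasisLeft b).injective
  ext i
  rw [TensorProduct.equivFinsuppOfBasisLeft_apply, TensorProduct.equivFinsuppOfBasisLeft_apply, h]

/-- Over a field, `g` factors through `f` if it vanishes on the kernel of `f`. -/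
theorem LinearMap.exists_comp_eq_of_ker_le {k M N P : Type*} [Field k] [AddCommGroup M]
    [Module k M] [AddCommGroup N] [Module k N] [AddCommGroup P] [Module k P]
    (f : M →ₗ[k] N) (g : M →ₗ[k] P) (h : LinearMap.ker f ≤ LinearMap.ker g) :
    ∃ l : N →ₗ[k] P, l ∘ₗ f = g := by
  obtain ⟨l, hl⟩ := LinearMap.exists_extend
    ((LinearMap.ker f).liftQ g h ∘ₗ f.quotKerEquivRange.symm.toLinearMap)
  refine ⟨l, LinearMap.ext fun x => ?_⟩
  refine (LinearMap.congr_fun hl ⟨f x, ⟨x, rfl⟩⟩).trans ?_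
  have e : f.quotKerEquivRange.symm ⟨f x, ⟨x, rfl⟩⟩ = Submodule.Quotient.mk x := by
    rw [LinearEquiv.symm_apply_eq]; rfl
  simp [e]

/-! ### Left comodules, coefficient spaces and a criterion for generation -/

section LeftComodules

variable {k : Type u} [Field k] {D : Type u} [AddCommGroup D] [Module k D] [Coalgebra k D]

namespace LeftComodule

variable {X : Type u} [AddCommGroup X] [Module k X] [LeftComodule k D X]

/-- The action `x · f = ∑ f(x₋₁) x₀` of functionals on a left comodule. -/
noncomputable def act (f : D →ₗ[k] k) : X →ₗ[k] X :=
  (TensorProduct.lid k X).toLinearMap ∘ₗ f.rTensor X ∘ₗ coact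

theorem act_apply (f : D →ₗ[k] k) (x : X) :
    act f x = TensorProduct.lid k X (f.rTensor X (coact x)) := rfl

/-- Coassociativity of the coaction, by the computation of `comul_sliceLeft` with `X` in place of
the last tensor factor. -/
theorem coact_act (f : D →ₗ[k] k) :
    coact ∘ₗ act (X := X) f = (sliceLeft f).rTensor X ∘ₗ coact := by
  have e1 : (coact (k := k) (C := D) (M := X)) ∘ₗ (TensorProduct.lid k X).toLinearMap ∘ₗ
      f.rTensor X = (TensorProduct.lid k (D ⊗[k] X)).toLinearMap ∘ₗ f.rTensor (D ⊗[k] X) ∘ₗ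
        (coact (k := k) (C := D) (M := X)).lTensor D := by
    ext; simp
  have e2 : (TensorProduct.lid k (D ⊗[k] X)).toLinearMap ∘ₗ f.rTensor (D ⊗[k] X) ∘ₗ
      (TensorProduct.assoc k D D X).toLinearMap =
      ((TensorProduct.lid k D).toLinearMap ∘ₗ f.rTensor D).rTensor X := by
    ext; simp [TensorProduct.smul_tmul']
  calc _ = ((coact (k := k) (C := D) (M := X)) ∘ₗ (TensorProduct.lid k X).toLinearMap ∘ₗ
        f.rTensor X) ∘ₗ coact := rfl
    _ = (TensorProduct.lid k (D ⊗[k] X)).toLinearMap ∘ₗ f.rTensor (D ⊗[k] X) ∘ₗ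
        ((coact (k := k) (C := D) (M := X)).lTensor D ∘ₗ coact) := by rw [e1]; rfl
    _ = ((TensorProduct.lid k (D ⊗[k] X)).toLinearMap ∘ₗ f.rTensor (D ⊗[k] X) ∘ₗ
        (TensorProduct.assoc k D D X).toLinearMap) ∘ₗ
          (Coalgebra.comul (R := k)).rTensor X ∘ₗ coact := by
        rw [← LeftComodule.coassoc]; rfl
    _ = _ := by
        rw [e2, ← LinearMap.comp_assoc, ← LinearMap.rTensor_comp]; rfl

theorem act_act (f g : D →ₗ[k] k) (x : X) : act g (act f x) = act (g ∘ₗ sliceLeft f) x := by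
  have h := LinearMap.congr_fun (coact_act (X := X) f) x
  simp only [LinearMap.comp_apply] at h
  rw [act_apply, h, act_apply, LinearMap.rTensor_comp, LinearMap.comp_apply]

theorem act_counit (x : X) : act (Coalgebra.counit (R := k) (A := D)) x = x := by
  have h := LinearMap.congr_fun (counit_coact (k := k) (C := D) (M := X)) x
  simp only [LinearMap.comp_apply] at h
  rw [act_apply, h]
  simp

/-- `f ↦ x · f`, as a linear map. -/
noncomputable def orbit (x : X) : (D →ₗ[k] k) →ₗ[k] X where
  toFun f := act f x
  map_add' f g := by simp [act_apply, LinearMap.rTensor_add]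
  map_smul' c f := by simp [act_apply, LinearMap.rTensor_smul]

/-- The slice `∑ x₋₁ g(x₀)` of `x` along the functional `g`. -/
noncomputable def coeff (x : X) (g : X →ₗ[k] k) : D :=
  TensorProduct.rid k D (g.lTensor D (coact x))

theorem sliceLeft_coeff (f : D →ₗ[k] k) (x : X) (g : X →ₗ[k] k) :
    sliceLeft f (coeff (D := D) x g) = coeff (act f x) g := by
  have h := LinearMap.congr_fun (coact_act (X := X) f) x
  simp only [LinearMap.comp_apply] at h
  rw [coeff, coeff, h]
  induction (coact x : D ⊗[k] X) with
  | zero => simp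
  | tmul a b => simp
  | add a b ha hb => simp only [map_add, ha, hb]

theorem apply_coeff (f : D →ₗ[k] k) (x : X) (g : X →ₗ[k] k) :
    f (coeff (D := D) x g) = g (act f x) := by
  rw [coeff, act_apply]
  induction (coact x : D ⊗[k] X) with
  | zero => simp
  | tmul a b => simp [mul_comm]
  | add a b ha hb => simp only [map_add, ha, hb]

/-- Pairing a coefficient of `x` along `g` with `l` gives `g (x · l)`; both sides have the same
pairing with every `l`. Consequently the coefficients of `x` span a right coideal. -/
theorem sliceRight_coeff (f : D →ₗ[k] k) (x : X) (g : X →ₗ[k] k) :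
    sliceRight f (coeff (D := D) x g) = coeff x (g ∘ₗ act f) := by
  rw [← sub_eq_zero, ← Module.forall_dual_apply_eq_zero_iff k]
  intro l
  rw [map_sub, sub_eq_zero, apply_sliceRight, sliceLeft_coeff, apply_coeff, apply_coeff]
  rfl

/-- The coefficient space of `x`: the span of all `∑ x₋₁ g(x₀)`. -/
noncomputable def coeffSpace (D : Type u) [AddCommGroup D] [Module k D] [Coalgebra k D]
    {X : Type u} [AddCommGroup X] [Module k X] [LeftComodule k D X] (x : X) : Submodule k D :=
  Submodule.span k (Set.range (coeff (D := D) (k := k) x))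

/-- The coaction of `x` is a finite sum of pure tensors, and their left factors span all
coefficients. -/
theorem finiteDimensional_coeffSpace (x : X) : FiniteDimensional k (coeffSpace (k := k) D x) := by
  obtain ⟨S, hS⟩ := TensorProduct.exists_finset (coact x : D ⊗[k] X)
  classical
  have hle : coeffSpace (k := k) D x ≤ Submodule.span k (S.image Prod.fst : Finset D) := by
    rw [coeffSpace, Submodule.span_le]
    rintro _ ⟨g, rfl⟩
    rw [coeff, hS]
    simp only [map_sum, LinearMap.lTensor_tmul, TensorProduct.rid_tmul, SetLike.mem_coe]
    exact Submodule.sum_mem _ fun i hi => Submodule.smul_mem _ _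
      (Submodule.subset_span (Finset.mem_image_of_mem _ hi))
  exact Submodule.finiteDimensional_of_le hle

theorem sliceRight_mem_coeffSpace (f : D →ₗ[k] k) (x : X) {m : D}
    (hm : m ∈ coeffSpace (k := k) D x) : sliceRight f m ∈ coeffSpace (k := k) D x := by
  induction hm using Submodule.span_induction with
  | mem m hm =>
    obtain ⟨g, rfl⟩ := hm
    rw [sliceRight_coeff]
    exact Submodule.subset_span ⟨_, rfl⟩
  | zero => simp
  | add a b _ _ ha hb => rw [map_add]; exact Submodule.add_mem _ ha hb
  | smul c a _ ha => rw [map_smul]; exact Submodule.smul_mem _ _ ha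

theorem act_eq_zero_of_coeffSpace {f : D →ₗ[k] k} {x : X}
    (h : ∀ m ∈ coeffSpace (k := k) D x, f m = 0) : act f x = 0 := by
  rw [← Module.forall_dual_apply_eq_zero_iff k]
  intro g
  have := h _ (Submodule.subset_span ⟨g, rfl⟩)
  rwa [apply_coeff] at this

theorem coeffSpace_act_le (f : D →ₗ[k] k) (x : X) :
    coeffSpace (k := k) D (act f x) ≤ LinearMap.range (sliceLeft f) := by
  rw [coeffSpace, Submodule.span_le]
  rintro _ ⟨g, rfl⟩
  rw [← sliceLeft_coeff]
  exact ⟨_, rfl⟩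

end LeftComodule

open CategoryTheory CategoryTheory.Limits

namespace LeftComod

variable (k D) in
/-- The coaction of the direct sum of copies of the regular left comodule. -/
noncomputable def freeCoact (I : Type u) : (I →₀ D) →ₗ[k] D ⊗[k] (I →₀ D) :=
  Finsupp.lsum k fun i => (Finsupp.lsingle i).lTensor D ∘ₗ Coalgebra.comul

theorem freeCoact_single (I : Type u) (i : I) (d : D) :
    freeCoact k D I (Finsupp.single i d) =
      (Finsupp.lsingle i : D →ₗ[k] I →₀ D).lTensor D (Coalgebra.comul d) := by
  simp [freeCoact]

variable (k D) in
/-- The direct sum of copies of the regular left comodule. -/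
noncomputable def free (I : Type u) : LeftComod k D where
  carrier := I →₀ D
  comodule :=
    { coact := freeCoact k D I
      coassoc := by
        refine Finsupp.lhom_ext' fun i => LinearMap.ext fun d => ?_
        have e1 : ∀ t : D ⊗[k] D, (freeCoact k D I).lTensor D
            ((Finsupp.lsingle i : D →ₗ[k] I →₀ D).lTensor D t) =
            ((Finsupp.lsingle i : D →ₗ[k] I →₀ D).lTensor D).lTensor D
              ((Coalgebra.comul (R := k)).lTensor D t) := by
          intro t
          induction t with
          | zero => simp
          | tmul a b => simp [freeCoact_single]
          | add a b ha hb => simp only [map_add, ha, hb]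
        have e2 : ∀ t : D ⊗[k] D, TensorProduct.assoc k D D (I →₀ D)
            ((Coalgebra.comul (R := k)).rTensor (I →₀ D)
              ((Finsupp.lsingle i : D →ₗ[k] I →₀ D).lTensor D t)) =
            ((Finsupp.lsingle i : D →ₗ[k] I →₀ D).lTensor D).lTensor D
              (TensorProduct.assoc k D D D ((Coalgebra.comul (R := k)).rTensor D t)) := by
          intro t
          induction t with
          | zero => simp
          | tmul a b =>
            simp only [LinearMap.lTensor_tmul, LinearMap.rTensor_tmul]
            induction (Coalgebra.comul a : D ⊗[k] D) with
            | zero => simp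
            | tmul a b => simp
            | add a b ha hb => simp only [TensorProduct.add_tmul, map_add, ha, hb]
          | add a b ha hb => simp only [map_add, ha, hb]
        simp only [LinearMap.comp_apply, LinearEquiv.coe_coe, Finsupp.lsingle_apply,
          freeCoact_single]
        rw [e1, e2, Coalgebra.coassoc_apply]
      counit_coact := by
        refine Finsupp.lhom_ext' fun i => LinearMap.ext fun d => ?_
        have e : ∀ t : D ⊗[k] D, (Coalgebra.counit (R := k)).rTensor (I →₀ D)
            ((Finsupp.lsingle i : D →ₗ[k] I →₀ D).lTensor D t) =
            (Finsupp.lsingle i : D →ₗ[k] I →₀ D).lTensor k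
              ((Coalgebra.counit (R := k)).rTensor D t) := by
          intro t
          induction t with
          | zero => simp
          | tmul a b => simp
          | add a b ha hb => simp only [map_add, ha, hb]
        simp only [LinearMap.comp_apply, Finsupp.lsingle_apply, freeCoact_single]
        rw [e, Coalgebra.rTensor_counit_comul]
        simp }

/-- The underlying linear map of a homomorphism from the regular comodule. -/
def Hom.ofRegular {X : LeftComod k D} (f : regular k D ⟶ X) : D →ₗ[k] X.carrier := f.toLinearMap

theorem Hom.coact_ofRegular {X : LeftComod k D} (f : regular k D ⟶ X) (d : D) :
    LeftComodule.coact (C := D) (Hom.ofRegular f d) =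
      (Hom.ofRegular f).lTensor D (Coalgebra.comul d) := LinearMap.congr_fun f.comm d

/-- The inclusion of a summand into the direct sum of copies of the regular left comodule. -/
noncomputable def freeInclusion (I : Type u) (i : I) : regular k D ⟶ free k D I where
  toLinearMap := (Finsupp.lsingle i : D →ₗ[k] I →₀ D)
  comm := LinearMap.ext (freeCoact_single I i : ∀ _ : D, _)

/-- The linear map from the direct sum with prescribed components. -/
noncomputable def freeDescLinear {I : Type u} {X : LeftComod k D} (h : I → (regular k D ⟶ X)) :
    (I →₀ D) →ₗ[k] X.carrier := Finsupp.lsum k fun i => Hom.ofRegular (h i)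

theorem freeDescLinear_single {I : Type u} {X : LeftComod k D} (h : I → (regular k D ⟶ X))
    (i : I) (d : D) : freeDescLinear h (Finsupp.single i d) = Hom.ofRegular (h i) d := by
  simp [freeDescLinear]

/-- The homomorphism from the direct sum with prescribed components. -/
noncomputable def freeDesc {I : Type u} {X : LeftComod k D} (h : I → (regular k D ⟶ X)) :
    free k D I ⟶ X where
  toLinearMap := freeDescLinear h
  comm := by
    refine Finsupp.lhom_ext' fun i => LinearMap.ext fun d => ?_
    change LeftComodule.coact (freeDescLinear h (Finsupp.single i d)) =
      LinearMap.lTensor D (freeDescLinear h) (freeCoact k D I (Finsupp.single i d))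
    rw [freeCoact_single, ← LinearMap.lTensor_comp_apply, freeDescLinear_single,
      Hom.coact_ofRegular]
    congr 2
    exact LinearMap.ext fun d => (freeDescLinear_single h i d).symm

/-- A coalgebra generates its left comodules as soon as every element of a left comodule is a sum
of values of homomorphisms from the regular comodule. -/
theorem generates_of_mem_iSup_range (h : ∀ (X : LeftComod k D) (x : X.carrier),
    x ∈ ⨆ f : regular k D ⟶ X, LinearMap.range (Hom.ofRegular f)) :
    GeneratesLeftComodules k D := by
  intro X
  -- One copy of `D` for each homomorphism `D ⟶ X`, mapped to `X` by that homomorphism.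
  refine ⟨(regular k D ⟶ X), Cofan.mk (free k D _) (freeInclusion _), freeDesc fun f => f,
    ⟨Cofan.IsColimit.mk _ (fun s => freeDesc s.inj) ?_ ?_⟩, ⟨?_⟩⟩
  · intro s j
    exact Hom.ext (LinearMap.ext (freeDescLinear_single _ j : ∀ _ : D, _))
  · intro s m hm
    refine Hom.ext (Finsupp.lhom_ext' fun i => LinearMap.ext fun d => ?_)
    exact (LinearMap.congr_fun (congrArg Hom.toLinearMap (hm i)) d).trans
      (freeDescLinear_single _ i d).symm
  · intro Z a b hab
    refine Hom.ext (LinearMap.ext fun x => ?_)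
    have hx : x ∈ LinearMap.range (freeDescLinear fun f : regular k D ⟶ X => f) := by
      refine (iSup_le fun f => ?_ : (⨆ f : regular k D ⟶ X, LinearMap.range (Hom.ofRegular f)) ≤ _)
        (h X x)
      rintro _ ⟨d, rfl⟩
      exact ⟨Finsupp.single f d, freeDescLinear_single _ f d⟩
    obtain ⟨y, rfl⟩ := hx
    exact LinearMap.congr_fun (congrArg Hom.toLinearMap hab) y

end LeftComod

/-- A linear map that commutes with the actions of functionals is a homomorphism. -/
theorem LeftComod.exists_hom_of_act {X : LeftComod k D} (h : D →ₗ[k] X.carrier)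
    (hh : ∀ (f : D →ₗ[k] k) (d : D), h (sliceLeft f d) = LeftComodule.act f (h d)) :
    ∃ H : LeftComod.regular k D ⟶ X, LeftComod.Hom.ofRegular H = h := by
  have key : ∀ d : D, LeftComodule.coact (C := D) (h d) = h.lTensor D (Coalgebra.comul d) := ?_
  · exact ⟨⟨h, LinearMap.ext key⟩, rfl⟩
  intro d
  apply TensorProduct.eq_of_forall_functional_left
  intro f
  refine (hh f d).symm.trans ?_
  rw [sliceLeft_apply]
  induction (Coalgebra.comul d : D ⊗[k] D) with
  | zero => simp
  | tmul a b => simp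
  | add a b ha hb => simp only [map_add, ha, hb]

-- The functionals `e a` cut an element of a comodule into pieces `y`, and `M` will be the
-- coefficient space of `y`. The last condition on `q` makes `q ↼ f ↦ y · f` well defined. The first
-- two make `η ⇀ ·` a map of `D` into `q ↼ D*` that fixes `q`, so the composite is a homomorphism
-- from all of `D` with `q ↦ y`.
open LeftComodule in
theorem generatesLeftComodules_of_pieces {V : Type u} (e : V → D →ₗ[k] k)
    (he : ∀ u : D, ∃ S₀ : Finset V, ∀ S, S₀ ⊆ S → Coalgebra.counit (R := k) u = ∑ a ∈ S, e a u)
    (h : ∀ a, ∀ M : Submodule k D, FiniteDimensional k M → M ≤ LinearMap.range (sliceLeft (e a)) →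
      (∀ f : D →ₗ[k] k, ∀ m ∈ M, sliceRight f m ∈ M) →
      ∃ (q : D) (η : D →ₗ[k] k), sliceRight η q = q ∧ (∀ d, ∃ f : D →ₗ[k] k, sliceRight η d = sliceLeft f q) ∧
        ∀ f : D →ₗ[k] k, sliceLeft f q = 0 → ∀ m ∈ M, f m = 0) :
    GeneratesLeftComodules k D := by
  classical
  refine LeftComod.generates_of_mem_iSup_range fun X x => ?_
  have key : ∀ a, act (e a) x ∈
      ⨆ f : LeftComod.regular k D ⟶ X, LinearMap.range (LeftComod.Hom.ofRegular f) := by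
    intro a
    have hle := coeffSpace_act_le (e a) x
    generalize act (e a) x = y at hle ⊢
    obtain ⟨q, η, h1, h2, h3⟩ := h a (coeffSpace (k := k) D y) (finiteDimensional_coeffSpace y)
      hle fun f m hm => sliceRight_mem_coeffSpace f y hm
    have hker : LinearMap.ker (leftOrbit q) ≤ LinearMap.ker (orbit (k := k) (D := D) y) := by
      intro f hf
      exact act_eq_zero_of_coeffSpace (h3 f hf)
    -- `h0` is linear on all of `D`, but only its values on `q ↼ D*` are controlled; composing with
    -- `η ⇀ ·` discards the rest.
    obtain ⟨h0, hh0⟩ := LinearMap.exists_comp_eq_of_ker_le _ _ hker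
    have h0' : ∀ f, h0 (sliceLeft f q) = act f y := fun f => LinearMap.congr_fun hh0 f
    obtain ⟨H, hH⟩ := LeftComod.exists_hom_of_act (h0 ∘ₗ sliceRight η) (by
      intro g d
      obtain ⟨f, hf⟩ := h2 d
      rw [LinearMap.comp_apply, LinearMap.comp_apply, sliceRight_sliceLeft, hf,
        sliceLeft_sliceLeft, h0', h0', ← act_act])
    refine Submodule.mem_iSup_of_mem H ⟨q, ?_⟩
    rw [hH, LinearMap.comp_apply, h1]
    have := h0' (Coalgebra.counit (R := k))
    rwa [sliceLeft_counit, act_counit] at this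
  -- Only finitely many elements of `D` occur in the coaction of `x`. A single finite index set on
  -- which the `e a` sum to the counit works for all of them, and `x` acted on by the counit is `x`.
  obtain ⟨T, hT⟩ := TensorProduct.exists_finset (coact x : D ⊗[k] X.carrier)
  choose S₀ hS₀ using he
  have hx : x = ∑ a ∈ T.biUnion (fun i => S₀ i.1), act (e a) x := by
    conv_lhs => rw [← act_counit (k := k) (D := D) x]
    simp only [act_apply, hT, map_sum, LinearMap.rTensor_tmul, TensorProduct.lid_tmul]
    rw [Finset.sum_comm]
    refine Finset.sum_congr rfl fun i hi => ?_
    rw [← Finset.sum_smul, hS₀ i.1 _ (Finset.subset_biUnion_of_mem (fun i => S₀ i.1) hi)]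
  rw [hx]
  exact Submodule.sum_mem _ fun a _ => key a

end LeftComodules

/-! ### Right comodules: injective summands, semiperfect and qcF coalgebras -/

section RightComodules

variable {k : Type u} [Field k] {D : Type u} [AddCommGroup D] [Module k D] [Coalgebra k D]

namespace RightComodule

variable {X : Type u} [AddCommGroup X] [Module k X] [RightComodule k D X]

/-- The map `x ↦ ∑ l(x₀) x₁` into the regular comodule. -/
noncomputable def toRegular (l : X →ₗ[k] k) : X →ₗ[k] D :=
  (TensorProduct.lid k D).toLinearMap ∘ₗ l.rTensor D ∘ₗ coact

/-- Coassociativity of the coaction makes `toRegular l` a homomorphism. With `counit_toRegular` and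
`eq_toRegular` this says that `D` is cofree: homomorphisms `X → D` correspond to functionals on `X`.
-/
theorem comul_toRegular (l : X →ₗ[k] k) :
    Coalgebra.comul ∘ₗ toRegular (D := D) l = (toRegular l).rTensor D ∘ₗ coact := by
  have e1 : (Coalgebra.comul (R := k) (A := D)) ∘ₗ (TensorProduct.lid k D).toLinearMap ∘ₗ
      l.rTensor D = (TensorProduct.lid k (D ⊗[k] D)).toLinearMap ∘ₗ l.rTensor (D ⊗[k] D) ∘ₗ
        (Coalgebra.comul (R := k)).lTensor X := by
    ext; simp
  have e2 : (TensorProduct.lid k (D ⊗[k] D)).toLinearMap ∘ₗ l.rTensor (D ⊗[k] D) ∘ₗ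
      (TensorProduct.assoc k X D D).toLinearMap =
      ((TensorProduct.lid k D).toLinearMap ∘ₗ l.rTensor D).rTensor D := by
    ext; simp [TensorProduct.smul_tmul']
  calc _ = ((Coalgebra.comul (R := k) (A := D)) ∘ₗ (TensorProduct.lid k D).toLinearMap ∘ₗ
        l.rTensor D) ∘ₗ coact := rfl
    _ = (TensorProduct.lid k (D ⊗[k] D)).toLinearMap ∘ₗ l.rTensor (D ⊗[k] D) ∘ₗ
        ((Coalgebra.comul (R := k)).lTensor X ∘ₗ coact) := by rw [e1]; rfl
    _ = ((TensorProduct.lid k (D ⊗[k] D)).toLinearMap ∘ₗ l.rTensor (D ⊗[k] D) ∘ₗ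
        (TensorProduct.assoc k X D D).toLinearMap) ∘ₗ
          (coact (k := k) (C := D) (M := X)).rTensor D ∘ₗ coact := by
        rw [← RightComodule.coassoc]; rfl
    _ = _ := by
        rw [e2, ← LinearMap.comp_assoc, ← LinearMap.rTensor_comp]; rfl

theorem counit_toRegular (l : X →ₗ[k] k) (x : X) :
    Coalgebra.counit (R := k) (toRegular (D := D) l x) = l x := by
  have h := LinearMap.congr_fun (counit_coact (k := k) (C := D) (M := X)) x
  have e : ∀ t : X ⊗[k] D, Coalgebra.counit (R := k) (TensorProduct.lid k D (l.rTensor D t)) =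
      l (TensorProduct.rid k X ((Coalgebra.counit (R := k)).lTensor X t)) := by
    intro t
    induction t with
    | zero => simp
    | tmul a b => simp [mul_comm]
    | add a b ha hb => simp only [map_add, ha, hb]
  refine (e _).trans ?_
  rw [LinearMap.comp_apply] at h
  rw [h]
  simp

/-- A homomorphism to the regular comodule is determined by its composite with the counit. -/
theorem eq_toRegular (G : X →ₗ[k] D) (hG : Coalgebra.comul ∘ₗ G = G.rTensor D ∘ₗ coact) :
    G = toRegular (Coalgebra.counit ∘ₗ G) := by
  ext x
  have h := LinearMap.congr_fun hG x
  simp only [LinearMap.comp_apply] at h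
  rw [toRegular, LinearMap.rTensor_comp]
  simp only [LinearMap.comp_apply]
  rw [← h]
  simp

/-- The kernel of a homomorphism to the regular comodule is a subcomodule. -/
theorem isSubcomodule_ker (G : X →ₗ[k] D)
    (hG : Coalgebra.comul ∘ₗ G = G.rTensor D ∘ₗ coact) :
    IsSubcomodule k D (LinearMap.ker G) := by
  intro x hx
  have h := LinearMap.congr_fun hG x
  simp only [LinearMap.comp_apply] at h
  rw [LinearMap.mem_ker.1 hx, map_zero] at h
  exact (Module.Flat.rTensor_exact D (LinearMap.exact_subtype_ker_map G) _).1 h.symm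

end RightComodule

open RightComodule

/-- A coalgebra is left semiperfect if all `D ↼ e a` are finite dimensional, for a family of
functionals `e a` that separates the elements on which the counit does not vanish. -/
theorem leftSemiperfect_of_finiteDimensional {V : Type*} (e : V → D →ₗ[k] k)
    (he : ∀ u : D, Coalgebra.counit (R := k) u ≠ 0 → ∃ a, e a u ≠ 0)
    (hfin : ∀ a, FiniteDimensional k (LinearMap.range (sliceLeft (e a)))) :
    LeftSemiperfect k D := by
  intro S E _ _ _ _ _ _ j hS hj
  obtain ⟨hnt, hsimple⟩ := hS
  obtain ⟨-, hj1, hj2, hj3⟩ := hj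
  obtain ⟨s, hs⟩ := exists_ne (0 : S)
  obtain ⟨l, hl⟩ : ∃ l : E →ₗ[k] k, l (j s) ≠ 0 := by
    by_contra! h
    exact hs (hj2 (((Module.forall_dual_apply_eq_zero_iff k (j s)).1 h).trans (map_zero j).symm))
  obtain ⟨a, ha⟩ := he (toRegular l (j s)) (by rwa [counit_toRegular])
  -- `G` is a homomorphism from the envelope to `D ↼ e a` that does not kill `j s`; it remains to
  -- see that it is injective.
  set G : E →ₗ[k] D := sliceLeft (e a) ∘ₗ toRegular l with hG
  have hGhom : Coalgebra.comul ∘ₗ G = G.rTensor D ∘ₗ coact := by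
    rw [hG, ← LinearMap.comp_assoc, comul_sliceLeft, LinearMap.comp_assoc, comul_toRegular,
      ← LinearMap.comp_assoc, LinearMap.rTensor_comp]
  have hGs : G (j s) ≠ 0 := by
    intro h
    apply ha
    rw [← counit_sliceLeft]
    exact (congrArg _ h).trans (map_zero _)
  -- By essentiality a nonzero kernel would meet `j S`. But the kernel of `G ∘ₗ j` is a proper
  -- subcomodule of the simple `S`, hence zero.
  have hker : LinearMap.ker G = ⊥ := by
    by_contra h
    apply hj3 _ (isSubcomodule_ker G hGhom) h
    have h2 : IsSubcomodule k D (LinearMap.ker (G ∘ₗ j)) := by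
      refine isSubcomodule_ker _ ?_
      rw [← LinearMap.comp_assoc, hGhom, LinearMap.comp_assoc, hj1, ← LinearMap.comp_assoc,
        LinearMap.rTensor_comp D G j]
    rcases hsimple _ h2 with h3 | h3
    · rw [eq_bot_iff]
      rintro _ ⟨hx, ⟨y, rfl⟩⟩
      have : y ∈ LinearMap.ker (G ∘ₗ j) := hx
      rw [h3] at this
      rw [(Submodule.mem_bot k).1 this, map_zero]
      exact zero_mem _
    · exact absurd (show s ∈ LinearMap.ker (G ∘ₗ j) by rw [h3]; trivial) hGs
  have := hfin a
  let G' : E →ₗ[k] LinearMap.range (sliceLeft (e a)) :=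
    G.codRestrict _ fun x => ⟨toRegular l x, rfl⟩
  refine Module.Finite.of_injective G' ?_
  exact LinearMap.ker_eq_bot.1 ((LinearMap.ker_codRestrict _ _ _).trans hker)

/-- The direct summand `D ↼ e` of the regular right comodule, for an idempotent functional `e`. -/
@[reducible]
noncomputable def sliceComodule (e : D →ₗ[k] k)
    (he : ∀ x, sliceLeft e (sliceLeft e x) = sliceLeft e x) :
    RightComodule k D (LinearMap.range (sliceLeft e)) where
  coact := (sliceLeft e).rangeRestrict.rTensor D ∘ₗ Coalgebra.comul ∘ₗ Submodule.subtype _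
  coassoc := by
    set P := LinearMap.range (sliceLeft e)
    set r : D →ₗ[k] P := (sliceLeft e).rangeRestrict
    -- Idempotence: `· ↼ e` is the identity on its range, so the range is a retract of `D`.
    have hi : sliceLeft e ∘ₗ P.subtype = P.subtype := by
      ext ⟨_, x, rfl⟩
      exact he x
    have h1 : (r.rTensor D ∘ₗ Coalgebra.comul ∘ₗ P.subtype).rTensor D ∘ₗ r.rTensor D =
        (r.rTensor D).rTensor D ∘ₗ (Coalgebra.comul (R := k)).rTensor D ∘ₗ
          (sliceLeft e).rTensor D := by
      rw [← LinearMap.rTensor_comp, ← LinearMap.rTensor_comp, ← LinearMap.rTensor_comp]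
      rfl
    have h2 : (TensorProduct.assoc k P D D).toLinearMap ∘ₗ (r.rTensor D).rTensor D =
        r.rTensor (D ⊗[k] D) ∘ₗ (TensorProduct.assoc k D D D).toLinearMap := by
      ext; rfl
    calc _ = (TensorProduct.assoc k P D D).toLinearMap ∘ₗ
          ((r.rTensor D ∘ₗ Coalgebra.comul ∘ₗ P.subtype).rTensor D ∘ₗ r.rTensor D) ∘ₗ
            Coalgebra.comul ∘ₗ P.subtype := rfl
      _ = ((TensorProduct.assoc k P D D).toLinearMap ∘ₗ (r.rTensor D).rTensor D) ∘ₗ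
            (Coalgebra.comul (R := k)).rTensor D ∘ₗ
              ((sliceLeft e).rTensor D ∘ₗ Coalgebra.comul) ∘ₗ P.subtype := by rw [h1]; rfl
      _ = r.rTensor (D ⊗[k] D) ∘ₗ ((TensorProduct.assoc k D D D).toLinearMap ∘ₗ
            (Coalgebra.comul (R := k)).rTensor D ∘ₗ Coalgebra.comul) ∘ₗ
              (sliceLeft e ∘ₗ P.subtype) := by rw [h2, ← comul_sliceLeft]; rfl
      _ = (r.rTensor (D ⊗[k] D) ∘ₗ (Coalgebra.comul (R := k)).lTensor D) ∘ₗ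
            Coalgebra.comul ∘ₗ P.subtype := by rw [Coalgebra.coassoc, hi]; rfl
      _ = _ := by
        rw [LinearMap.rTensor_comp_lTensor, ← LinearMap.lTensor_comp_rTensor]; rfl
  counit_coact := by
    have h1 : (Coalgebra.counit (R := k) (A := D)).lTensor (LinearMap.range (sliceLeft e)) ∘ₗ
        (sliceLeft e).rangeRestrict.rTensor D = (sliceLeft e).rangeRestrict.rTensor k ∘ₗ
          (Coalgebra.counit (R := k) (A := D)).lTensor D := by
      rw [LinearMap.rTensor_comp_lTensor, ← LinearMap.lTensor_comp_rTensor]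
    rw [← LinearMap.comp_assoc, h1]
    ext ⟨_, x, rfl⟩
    simp only [LinearMap.comp_apply, Submodule.subtype_apply]
    rw [Coalgebra.lTensor_counit_comul]
    simp only [LinearMap.rTensor_tmul, LinearMap.flip_apply, TensorProduct.mk_apply]
    congr 1
    exact Subtype.ext (he x)

/-- A retract of the cofree comodule `D` is injective. Followed by the counit, `f` is a functional
on `X`; extend it to `Y`, turn the extension into a homomorphism `Y → D`, and project by `· ↼ e`. -/
theorem isInjective_sliceComodule (e : D →ₗ[k] k)
    (he : ∀ x, sliceLeft e (sliceLeft e x) = sliceLeft e x) :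
    @RightComodule.IsInjective k _ D _ _ _ (LinearMap.range (sliceLeft e)) _ _
      (sliceComodule e he) := by
  set P := LinearMap.range (sliceLeft e)
  let _ : RightComodule k D P := sliceComodule e he
  intro X Y _ _ _ _ _ _ i f hi hinj hf
  set r : D →ₗ[k] P := (sliceLeft e).rangeRestrict
  have hPi : ∀ x : P, sliceLeft e (x : D) = x := by
    rintro ⟨_, x, rfl⟩
    exact he x
  have hcoact : (coact : P →ₗ[k] P ⊗[k] D) = r.rTensor D ∘ₗ Coalgebra.comul ∘ₗ P.subtype := rfl
  have hincl : Coalgebra.comul ∘ₗ P.subtype = P.subtype.rTensor D ∘ₗ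
      (coact : P →ₗ[k] P ⊗[k] D) := by
    rw [hcoact, ← LinearMap.comp_assoc, ← LinearMap.rTensor_comp]
    change _ = (sliceLeft e).rTensor D ∘ₗ Coalgebra.comul ∘ₗ P.subtype
    rw [← LinearMap.comp_assoc, ← comul_sliceLeft]
    ext x
    exact congrArg _ (hPi x).symm
  have hF : Coalgebra.comul ∘ₗ (P.subtype ∘ₗ f) = (P.subtype ∘ₗ f).rTensor D ∘ₗ coact := by
    rw [← LinearMap.comp_assoc, hincl, LinearMap.comp_assoc, hf, ← LinearMap.comp_assoc,
      LinearMap.rTensor_comp]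
  obtain ⟨l, hl⟩ : ∃ l : Y →ₗ[k] k, l ∘ₗ i = Coalgebra.counit ∘ₗ P.subtype ∘ₗ f :=
    LinearMap.exists_comp_eq_of_ker_le _ _ (by rw [LinearMap.ker_eq_bot.2 hinj]; exact bot_le)
  refine ⟨r ∘ₗ toRegular l, ?_, ?_⟩
  · have h1 : (Coalgebra.comul ∘ₗ P.subtype) ∘ₗ r =
        (sliceLeft e).rTensor D ∘ₗ Coalgebra.comul := comul_sliceLeft e
    have h2 : r.rTensor D ∘ₗ (sliceLeft e).rTensor D = r.rTensor D := by
      rw [← LinearMap.rTensor_comp]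
      congr 1
      ext x
      exact he x
    calc (coact : P →ₗ[k] P ⊗[k] D) ∘ₗ r ∘ₗ toRegular l
        = r.rTensor D ∘ₗ ((Coalgebra.comul ∘ₗ P.subtype) ∘ₗ r) ∘ₗ toRegular l := rfl
      _ = (r.rTensor D ∘ₗ (sliceLeft e).rTensor D) ∘ₗ Coalgebra.comul ∘ₗ toRegular l := by
        rw [h1]; rfl
      _ = _ := by rw [h2, comul_toRegular, ← LinearMap.comp_assoc, ← LinearMap.rTensor_comp]
  · have h1 : toRegular l ∘ₗ i = P.subtype ∘ₗ f := by
      rw [eq_toRegular _ hF, ← hl, toRegular, toRegular, LinearMap.comp_assoc, LinearMap.comp_assoc,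
        hi, LinearMap.rTensor_comp]
      rfl
    rw [LinearMap.comp_assoc, h1]
    ext x
    exact hPi (f x)

/-- The one-dimensional comodule of a grouplike element. -/
@[reducible]
noncomputable def grouplikeComodule (g : D) (hg : Coalgebra.comul g = g ⊗ₜ[k] g)
    (hg' : Coalgebra.counit (R := k) g = 1) : RightComodule k D k where
  coact := LinearMap.toSpanSingleton k _ (1 ⊗ₜ[k] g)
  coassoc := by
    ext
    simp [hg]
  counit_coact := by
    ext
    simp [hg']

/-- If `D ↼ e` is an essential extension of a grouplike and infinite dimensional, then `D` is not
left semiperfect. -/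
theorem not_leftSemiperfect_of_slice (e : D →ₗ[k] k)
    (he : ∀ x, sliceLeft e (sliceLeft e x) = sliceLeft e x) (g : D) (hg : Coalgebra.comul g = g ⊗ₜ[k] g)
    (hg' : Coalgebra.counit (R := k) g = 1) (hge : sliceLeft e g = g)
    (hess : ∀ x, sliceLeft e x = x → x ≠ 0 → ∃ f : D →ₗ[k] k, sliceRight f x = g)
    (hinf : ¬ FiniteDimensional k (LinearMap.range (sliceLeft e))) : ¬ LeftSemiperfect k D := by
  intro H
  let _ := sliceComodule e he
  let _ := grouplikeComodule g hg hg'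
  let g' : LinearMap.range (sliceLeft e) := ⟨g, g, hge⟩
  have hg0 : g ≠ 0 := by rintro rfl; simp at hg'
  -- The simple comodule is the line spanned by `g`, and `D ↼ e` is its injective envelope.
  refine hinf (H k (LinearMap.range (sliceLeft e)) (LinearMap.toSpanSingleton k _ g') ⟨inferInstance, ?_⟩
    ⟨isInjective_sliceComodule e he, ?_, ?_, ?_⟩)
  · intro P _
    exact eq_bot_or_eq_top P
  · refine LinearMap.ext_ring ?_
    change (sliceLeft e).rangeRestrict.rTensor D (Coalgebra.comul
      ((LinearMap.toSpanSingleton k _ g' 1 : LinearMap.range (sliceLeft e)) : D)) =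
      LinearMap.rTensor D _ (LinearMap.toSpanSingleton k _ (1 ⊗ₜ[k] g) 1)
    simp only [LinearMap.toSpanSingleton_apply, one_smul, LinearMap.rTensor_tmul]
    change (sliceLeft e).rangeRestrict.rTensor D (Coalgebra.comul g) = _
    rw [hg, LinearMap.rTensor_tmul]
    congr 1
    exact Subtype.ext hge
  · intro a b hab
    have : (a - b) • g' = 0 := by
      rw [sub_smul, sub_eq_zero]; exact hab
    rcases smul_eq_zero.1 this with h | h
    · exact sub_eq_zero.1 h
    · exact absurd (congrArg Subtype.val h) hg0
  · intro P hP hne h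
    obtain ⟨x, hx, hx0⟩ := (Submodule.ne_bot_iff P).1 hne
    have hxe : sliceLeft e (x : D) = x := by
      obtain ⟨_, y, rfl⟩ := x
      exact he y
    obtain ⟨f, hf⟩ := hess x hxe (fun h => hx0 (Subtype.ext h))
    -- A subcomodule is closed under `f ⇀ ·`, so it contains `g = f ⇀ x`.
    have hgP : g' ∈ P := by
      obtain ⟨t, ht⟩ := hP x hx
      have h1 : TensorProduct.rid k _ (f.lTensor _ (P.subtype.rTensor D t)) ∈ P := by
        clear ht
        induction t with
        | zero => simp
        | tmul a b => simpa using P.smul_mem _ a.2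
        | add a b ha hb => simp only [map_add]; exact P.add_mem ha hb
      rw [ht] at h1
      convert h1
      refine Subtype.ext ?_
      change g = _
      have e1 : ∀ t : D ⊗[k] D, ((TensorProduct.rid k _ (f.lTensor _
          ((sliceLeft e).rangeRestrict.rTensor D t)) : LinearMap.range (sliceLeft e)) : D) =
          TensorProduct.rid k D (f.lTensor D ((sliceLeft e).rTensor D t)) := by
        intro t
        induction t with
        | zero => simp
        | tmul a b => simp
        | add a b ha hb => simp only [map_add, Submodule.coe_add, ha, hb]
      refine Eq.trans ?_ (e1 (Coalgebra.comul (x : D))).symm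
      have e2 := LinearMap.congr_fun (comul_sliceLeft e) (x : D)
      simp only [LinearMap.comp_apply] at e2
      rw [← e2, hxe]
      exact hf.symm
    have : g' ∈ P ⊓ LinearMap.range (LinearMap.toSpanSingleton k _ g') :=
      ⟨hgP, 1, by simp⟩
    rw [h] at this
    exact hg0 (congrArg Subtype.val ((Submodule.mem_bot k).1 this))

/-- If `D ↼ e` is an essential extension of a grouplike and infinite dimensional, then `D` is not
left quasi-coFrobenius. -/
theorem not_leftQuasiCoFrobenius_of_slice (e : D →ₗ[k] k) (g : D) (hg0 : g ≠ 0)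
    (hess : ∀ x ∈ LinearMap.range (sliceLeft e), x ≠ 0 → ∃ f : D →ₗ[k] k, sliceRight f x = g)
    (hinf : ¬ FiniteDimensional k (LinearMap.range (sliceLeft e))) :
    ¬ LeftQuasiCoFrobenius k D := by
  let _ := leftDualModule k D
  rintro ⟨ι, F, hF⟩
  have hsmul : ∀ (f : D →ₗ[k] k) (x : D), (WithConv.toConv f) • x = sliceRight f x :=
    fun f x => rfl
  have hFg : F g ≠ 0 := fun h => hg0 (hF (h.trans (map_zero F).symm))
  obtain ⟨i, hi⟩ := Finsupp.ne_iff.1 hFg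
  have hi' : (F g i).ofConv ≠ 0 := fun h => hi (WithConv.ofConv_injective h)
  obtain ⟨d, hd⟩ : ∃ d, (F g i).ofConv d ≠ 0 := by
    by_contra! h
    exact hi' (LinearMap.ext h)
  obtain ⟨S, hS⟩ := TensorProduct.exists_finset (Coalgebra.comul d : D ⊗[k] D)
  -- Linearity of `F` over the dual algebra, read in the coordinate `i`: `F (f ⇀ x)` is the
  -- convolution product `f * F x`.
  have hFf : ∀ (f : D →ₗ[k] k) (x v : D),
      (F (sliceRight f x) i).ofConv v = (F x i).ofConv (sliceLeft f v) := by
    intro f x v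
    rw [← hsmul, map_smul]
    change (WithConv.toConv f * F x i).ofConv v = _
    rw [LinearMap.convMul_def]
    change LinearMap.mul' k k (TensorProduct.map f (F x i).ofConv (Coalgebra.comul v)) = _
    rw [sliceLeft_apply]
    induction (Coalgebra.comul v : D ⊗[k] D) with
    | zero => simp
    | tmul a b => simp
    | add a b ha hb => simp only [map_add, ha, hb]
  -- Evaluate the `i`-th coordinate at the right factors of the comultiplication of `d`. The target
  -- is finite dimensional, so some `x ≠ 0` is killed. With `f ⇀ x = g`, the value of `F g` at `d`
  -- is `∑ f(d₁) (F x)(d₂) = 0`, a contradiction.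
  let Φ : LinearMap.range (sliceLeft e) →ₗ[k] (S → k) :=
    { toFun := fun x s => (F (x : D) i).ofConv s.1.2
      map_add' := fun x y => by ext s; simp
      -- `F` is linear over the dual algebra only; a scalar `c` of the field acts as the functional
      -- `c • ε`.
      map_smul' := fun c x => by
        ext s
        have h1 : sliceRight (c • Coalgebra.counit (R := k) (A := D)) (x : D) = c • (x : D) := by
          simp [sliceRight_apply, LinearMap.lTensor_smul]
        have h2 := hFf (c • Coalgebra.counit (R := k) (A := D)) (x : D) s.1.2
        rw [h1] at h2
        change (F (c • (x : D)) i).ofConv s.1.2 = c • (F (x : D) i).ofConv s.1.2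
        rw [h2, ← map_smul]
        simp [sliceLeft_apply, LinearMap.rTensor_smul] }
  have : ¬ Function.Injective Φ := fun h => hinf (Module.Finite.of_injective Φ h)
  rw [← LinearMap.ker_eq_bot, ← ne_eq, Submodule.ne_bot_iff] at this
  obtain ⟨x, hx, hx0⟩ := this
  obtain ⟨f, hf⟩ := hess x x.2 fun h => hx0 (Subtype.ext h)
  apply hd
  rw [← hf, hFf, sliceLeft_apply, hS]
  simp only [map_sum, LinearMap.rTensor_tmul, TensorProduct.lid_tmul, map_smul]
  refine Finset.sum_eq_zero fun s hs => ?_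
  have : (F (x : D) i).ofConv s.2 = 0 := congrFun hx ⟨s, hs⟩
  rw [this, smul_zero]

end RightComodules

/-! ### Coefficients of paths and projections to sources and targets -/

namespace PathCoalgebra

variable {k : Type u} [Field k] {V : Type u} [Quiver.{u} V]

variable (k) in
/-- The coefficient of a path. -/
noncomputable def coeffAt (p : AnyPath V) : PathCoalgebra k V →ₗ[k] k := Finsupp.lapply p

theorem ext_coeffAt {x y : PathCoalgebra k V} (h : ∀ p, coeffAt k p x = coeffAt k p y) : x = y :=
  Finsupp.ext h

theorem mem_support {x : PathCoalgebra k V} {p : AnyPath V} :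
    p ∈ x.support ↔ coeffAt k p x ≠ 0 := Finsupp.mem_support_iff

open Classical in
theorem coeffAt_of (p : AnyPath V) {a b : V} (q : Quiver.Path a b) :
    coeffAt k p (of k q) = if (⟨a, b, q⟩ : AnyPath V) = p then 1 else 0 :=
  Finsupp.single_apply

@[elab_as_elim]
theorem induction_linear {P : PathCoalgebra k V → Prop} (x : PathCoalgebra k V) (zero : P 0)
    (add : ∀ x y, P x → P y → P (x + y))
    (smul_of : ∀ (c : k) {a b : V} (p : Quiver.Path a b), P (c • of k p)) : P x := by
  refine Finsupp.induction_linear x zero add fun p c => ?_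
  have h := smul_of c p.path
  have e : c • of k p.path = Finsupp.single p c := by
    unfold of
    exact (Finsupp.smul_single c p (1 : k)).trans (by simp)
  rwa [e] at h

theorem sliceRight_of (f : PathCoalgebra k V →ₗ[k] k) {a b : V} (q : Quiver.Path a b) :
    sliceRight f (of k q) =
      (q.factorizations.map fun s => f (of k s.2.2) • of k s.2.1).sum := by
  rw [sliceRight_apply, comul_of, map_list_sum, map_list_sum, List.map_map, List.map_map]
  rfl

/-- The coefficient of `r` in `p ⇀ x` is the coefficient of `r p` in `x`. -/
theorem coeffAt_sliceRight {a b c : V} (r : Quiver.Path a b) (p : Quiver.Path b c)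
    (x : PathCoalgebra k V) : coeffAt k ⟨a, b, r⟩ (sliceRight (coeffAt k ⟨b, c, p⟩) x) =
      coeffAt k ⟨a, c, r.comp p⟩ x := by
  classical
  suffices h : coeffAt k ⟨a, b, r⟩ ∘ₗ sliceRight (coeffAt k ⟨b, c, p⟩) =
      coeffAt k ⟨a, c, r.comp p⟩ from LinearMap.congr_fun h x
  refine hom_ext fun {a' c'} q => ?_
  rw [LinearMap.comp_apply, sliceRight_of, map_list_sum, List.map_map, coeffAt_of]
  simp only [Function.comp_def, map_smul, coeffAt_of, smul_eq_mul, mul_ite, mul_one, mul_zero]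
  split_ifs with h
  · cases h
    rw [List.sum_map_eq_nsmul_single
      (⟨b, r, p⟩ : Σ b : V, Quiver.Path a b × Quiver.Path b c)]
    · rw [List.count_eq_one_of_mem (Quiver.Path.nodup_factorizations _)
        ((Quiver.Path.mem_factorizations _ _ _).2 rfl)]
      simp
    · rintro ⟨b', r', p'⟩ hne _
      dsimp only
      split_ifs with h1 h2
      · cases h1
        cases h2
        exact absurd rfl hne
      · rfl
      · rfl
  · apply List.sum_eq_zero
    intro t ht
    obtain ⟨⟨b', r', p'⟩, hs, rfl⟩ := List.mem_map.1 ht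
    dsimp only
    split_ifs with h1 h2
    · cases h1
      cases h2
      exact absurd (by rw [(Quiver.Path.mem_factorizations _ _ _).1 hs]) h
    · rfl
    · rfl

theorem coeffAt_sliceRight_of_ne {r p : AnyPath V} (h : r.tgt ≠ p.src)
    (x : PathCoalgebra k V) : coeffAt k r (sliceRight (coeffAt k p) x) = 0 := by
  classical
  suffices h : coeffAt k r ∘ₗ sliceRight (coeffAt k p) = 0 from LinearMap.congr_fun h x
  refine hom_ext fun {a' c'} q => ?_
  rw [LinearMap.comp_apply, sliceRight_of, map_list_sum, List.map_map, LinearMap.zero_apply]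
  simp only [Function.comp_def, map_smul, coeffAt_of, smul_eq_mul, mul_ite, mul_one, mul_zero]
  apply List.sum_eq_zero
  intro t ht
  obtain ⟨⟨b', r', p'⟩, hs, rfl⟩ := List.mem_map.1 ht
  dsimp only
  split_ifs with h1 h2
  · subst h1
    subst h2
    exact absurd rfl h
  · rfl
  · rfl

variable (k) in
/-- The coefficient of the trivial path at a vertex. -/
noncomputable def vertexCoeff (a : V) : PathCoalgebra k V →ₗ[k] k :=
  coeffAt k ⟨a, a, Quiver.Path.nil⟩

-- The only factorization of a path with a trivial second factor splits it at its target, so acting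
-- by `vertexCoeff k b` on this side is the projection to the paths that end at `b`.
open Classical in
theorem coeffAt_sliceRight_vertexCoeff (p : AnyPath V) (b : V) (x : PathCoalgebra k V) :
    coeffAt k p (sliceRight (vertexCoeff k b) x) = if p.tgt = b then coeffAt k p x else 0 := by
  split_ifs with h
  · subst h
    exact coeffAt_sliceRight p.path Quiver.Path.nil x
  · exact coeffAt_sliceRight_of_ne h x

open Classical in
theorem coeffAt_sliceLeft_vertexCoeff (p : AnyPath V) (a : V) (x : PathCoalgebra k V) :
    coeffAt k p (sliceLeft (vertexCoeff k a) x) = if p.src = a then coeffAt k p x else 0 := by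
  rw [vertexCoeff, ← apply_sliceRight]
  split_ifs with h
  · subst h
    rw [coeffAt_sliceRight Quiver.Path.nil p.path x, Quiver.Path.nil_comp]
  · exact coeffAt_sliceRight_of_ne (Ne.symm h) x

theorem sliceRight_vertexCoeff_eq_self {b : V} {x : PathCoalgebra k V} :
    sliceRight (vertexCoeff k b) x = x ↔ ∀ p ∈ x.support, p.tgt = b := by
  classical
  constructor
  · intro h p hp
    rw [mem_support, ← h, coeffAt_sliceRight_vertexCoeff] at hp
    by_contra hne
    simp [hne] at hp
  · intro h
    refine ext_coeffAt fun p => ?_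
    rw [coeffAt_sliceRight_vertexCoeff]
    split_ifs with h1
    · rfl
    · by_contra h2
      exact h1 (h p (mem_support.2 (Ne.symm h2)))

theorem sliceRight_vertexCoeff_eq_zero {b : V} {x : PathCoalgebra k V}
    (h : ∀ p ∈ x.support, p.tgt ≠ b) : sliceRight (vertexCoeff k b) x = 0 := by
  classical
  refine ext_coeffAt fun p => ?_
  rw [coeffAt_sliceRight_vertexCoeff, map_zero]
  split_ifs with h1
  · by_contra h2
    exact h p (mem_support.2 h2) h1
  · rfl

theorem sliceLeft_vertexCoeff_eq_self {a : V} {x : PathCoalgebra k V} :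
    sliceLeft (vertexCoeff k a) x = x ↔ ∀ p ∈ x.support, p.src = a := by
  classical
  constructor
  · intro h p hp
    rw [mem_support, ← h, coeffAt_sliceLeft_vertexCoeff] at hp
    by_contra hne
    simp [hne] at hp
  · intro h
    refine ext_coeffAt fun p => ?_
    rw [coeffAt_sliceLeft_vertexCoeff]
    split_ifs with h1
    · rfl
    · by_contra h2
      exact h1 (h p (mem_support.2 (Ne.symm h2)))

theorem sliceLeft_vertexCoeff_idem (a : V) (x : PathCoalgebra k V) :
    sliceLeft (vertexCoeff k a) (sliceLeft (vertexCoeff k a) x) =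
      sliceLeft (vertexCoeff k a) x := by
  classical
  refine ext_coeffAt fun p => ?_
  simp only [coeffAt_sliceLeft_vertexCoeff]
  split_ifs <;> rfl

/-- The counit is the sum of all `vertexCoeff k a`, and only finitely many of them are nonzero on
`u`. Allowing every larger `S` makes it possible to use a common finite set for several elements. -/
theorem exists_counit_eq_sum (u : PathCoalgebra k V) : ∃ S₀ : Finset V, ∀ S, S₀ ⊆ S →
    Coalgebra.counit (R := k) u = ∑ a ∈ S, vertexCoeff k a u := by
  classical
  induction u using induction_linear with
  | zero => exact ⟨∅, fun S _ => by simp⟩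
  | add x y hx hy =>
    obtain ⟨S, hS⟩ := hx
    obtain ⟨T, hT⟩ := hy
    refine ⟨S ∪ T, fun U hU => ?_⟩
    simp only [map_add, Finset.sum_add_distrib]
    rw [hS U (Finset.union_subset_left hU), hT U (Finset.union_subset_right hU)]
  | @smul_of c a b p =>
    refine ⟨{a}, fun S hS => ?_⟩
    simp only [map_smul, ← Finset.smul_sum]
    congr 1
    rw [counit_of, Finset.sum_eq_single_of_mem a (hS (Finset.mem_singleton_self a))]
    · rw [vertexCoeff, coeffAt_of]
      cases p with
      | nil => simp
      | cons p e =>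
        rw [if_neg (by simp), if_neg]
        intro h
        obtain ⟨-, rfl, h⟩ := AnyPath.mk.inj h
        exact Quiver.Path.cons_ne_nil _ _ (eq_of_heq h)
    · intro d _ hd
      rw [vertexCoeff, coeffAt_of, if_neg]
      intro h
      exact hd (congrArg AnyPath.src h).symm

/-- A nonzero combination of paths with source `a` can be cut down to the trivial path at `a`. -/
theorem exists_sliceRight_eq_of_nil {a : V} {x : PathCoalgebra k V} (hx : x ≠ 0)
    (h : ∀ p ∈ x.support, p.src = a) :
    ∃ f : PathCoalgebra k V →ₗ[k] k, sliceRight f x = of k (Quiver.Path.nil : Quiver.Path a a) := by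
  classical
  have hne : x.support.Nonempty := by
    by_contra h0
    refine hx (ext_coeffAt fun p => ?_)
    by_contra h1
    exact h0 ⟨p, mem_support.2 (by rwa [map_zero] at h1)⟩
  -- Let `p` be a longest path in `x`. The coefficient of `r` in `p ⇀ x` is that of `r p` in `x`,
  -- which vanishes for nontrivial `r` by maximality. For trivial `r` it is the coefficient of `p`,
  -- whose inverse normalizes the functional.
  obtain ⟨⟨a', c, p⟩, hp, hmax⟩ := x.support.exists_max_image (fun p => p.path.length) hne
  obtain rfl : a' = a := h _ hp
  refine ⟨(coeffAt k ⟨a', c, p⟩ x)⁻¹ • coeffAt k ⟨a', c, p⟩, ext_coeffAt ?_⟩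
  have e : ∀ (t : k) (f : PathCoalgebra k V →ₗ[k] k), sliceRight (t • f) x = t • sliceRight f x := by
    intro t f
    simp [sliceRight_apply, LinearMap.lTensor_smul]
  rintro ⟨d, b, r⟩
  rw [e, map_smul, coeffAt_of]
  split_ifs with h1
  · cases h1
    rw [coeffAt_sliceRight, Quiver.Path.nil_comp, smul_eq_mul, inv_mul_cancel₀ (mem_support.1 hp)]
  · by_cases hb : b = a'
    · subst hb
      rw [coeffAt_sliceRight]
      by_contra h2
      have h3 := hmax ⟨d, c, r.comp p⟩ (mem_support.2 fun h3 => h2 (by rw [h3, smul_zero]))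
      rw [Quiver.Path.length_comp] at h3
      cases r with
      | nil => exact h1 rfl
      | cons r e => simp at h3
    · rw [coeffAt_sliceRight_of_ne hb, smul_zero]

variable (k) in
/-- The combinations of paths with source `a`. -/
noncomputable def withSource (a : V) : Submodule k (PathCoalgebra k V) :=
  LinearMap.range (sliceLeft (vertexCoeff k a))

theorem mem_withSource {a : V} {x : PathCoalgebra k V} :
    x ∈ withSource k a ↔ ∀ p ∈ x.support, p.src = a := by
  rw [← sliceLeft_vertexCoeff_eq_self]
  constructor
  · rintro ⟨y, rfl⟩
    exact sliceLeft_vertexCoeff_idem a y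
  · intro h
    exact ⟨x, h⟩

theorem comul_of_nil (a : V) :
    (Coalgebra.comul (of k (Quiver.Path.nil : Quiver.Path a a)) :
      PathCoalgebra k V ⊗[k] PathCoalgebra k V) =
      of k (Quiver.Path.nil : Quiver.Path a a) ⊗ₜ[k] of k (Quiver.Path.nil : Quiver.Path a a) := by
  rw [comul_of]
  simp [Quiver.Path.factorizations]

end PathCoalgebra

/-! ### Subcoalgebras of path coalgebras: the pieces with a given source -/

namespace Subcoalgebra

open PathCoalgebra

variable {k : Type u} [Field k] {V : Type u} [Quiver.{u} V]
  (D : Subcoalgebra k (PathCoalgebra k V))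

/-- The coefficient of a trivial path, as a functional on a subcoalgebra. -/
noncomputable def vertexFunctional (a : V) : D.carrier →ₗ[k] k :=
  vertexCoeff k a ∘ₗ D.carrier.subtype

theorem coe_sliceLeft_vertexFunctional (a : V) (x : D.carrier) :
    (sliceLeft (D.vertexFunctional a) x : PathCoalgebra k V) =
      sliceLeft (vertexCoeff k a) (x : PathCoalgebra k V) := coe_sliceLeft D _ x

theorem exists_counit_eq_sum (u : D.carrier) : ∃ S₀ : Finset V, ∀ S, S₀ ⊆ S →
    Coalgebra.counit (R := k) u = ∑ a ∈ S, D.vertexFunctional a u :=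
  PathCoalgebra.exists_counit_eq_sum (u : PathCoalgebra k V)

/-- Lets dimensions and supports of the pieces of `D` be studied in the ambient path coalgebra. -/
theorem map_range_sliceLeft_vertexFunctional (a : V) :
    (LinearMap.range (sliceLeft (D.vertexFunctional a))).map D.carrier.subtype =
      D.carrier ⊓ withSource k a := by
  ext x
  constructor
  · rintro ⟨_, ⟨y, rfl⟩, rfl⟩
    exact ⟨Subtype.property _, ⟨(y : PathCoalgebra k V),
      (coe_sliceLeft_vertexFunctional D a y).symm⟩⟩
  · rintro ⟨hx, hxa⟩
    refine ⟨⟨x, hx⟩, ⟨⟨x, hx⟩, Subtype.ext ?_⟩, rfl⟩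
    rw [coe_sliceLeft_vertexFunctional]
    exact sliceLeft_vertexCoeff_eq_self.2 (mem_withSource.1 hxa)

theorem finiteDimensional_range_sliceLeft_iff (a : V) :
    FiniteDimensional k (LinearMap.range (sliceLeft (D.vertexFunctional a))) ↔
      FiniteDimensional k (D.carrier ⊓ withSource k a : Submodule k (PathCoalgebra k V)) := by
  rw [← map_range_sliceLeft_vertexFunctional]
  exact Module.Finite.equiv_iff
    (Submodule.equivMapOfInjective _ D.carrier.injective_subtype _)

theorem exists_infinite_of_not_leftSemiperfect (h : ¬ LeftSemiperfect k D.carrier) :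
    ∃ a, ¬ FiniteDimensional k (D.carrier ⊓ withSource k a : Submodule k (PathCoalgebra k V)) := by
  by_contra! hfin
  refine h (leftSemiperfect_of_finiteDimensional D.vertexFunctional (fun u hu => ?_)
    fun a => (D.finiteDimensional_range_sliceLeft_iff a).2 (hfin a))
  by_contra! h0
  obtain ⟨S, hS⟩ := D.exists_counit_eq_sum u
  exact hu ((hS S subset_rfl).trans (Finset.sum_eq_zero fun a _ => h0 a))

/-- The trivial path at `a` is grouplike, and `exists_sliceRight_eq_of_nil` makes the piece with
source `a` an essential extension of it. Since the piece is nonzero, the same cut also shows that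
the trivial path lies in `D`. -/
theorem not_leftSemiperfect_and_not_leftQuasiCoFrobenius {a : V}
    (h : ¬ FiniteDimensional k (D.carrier ⊓ withSource k a : Submodule k (PathCoalgebra k V))) :
    ¬ LeftSemiperfect k D.carrier ∧ ¬ LeftQuasiCoFrobenius k D.carrier := by
  have hinf := mt (D.finiteDimensional_range_sliceLeft_iff a).1 h
  obtain ⟨x, hx, hx0⟩ := (Submodule.ne_bot_iff _).1
    (show D.carrier ⊓ withSource k a ≠ ⊥ by rintro h0; rw [h0] at h; exact h inferInstance)
  set n := of k (Quiver.Path.nil : Quiver.Path a a) with hn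
  have hnD : n ∈ D.carrier := by
    obtain ⟨f, hf⟩ := exists_sliceRight_eq_of_nil hx0 (mem_withSource.1 hx.2)
    rw [hn, ← hf]
    exact D.isSubcoalgebra.sliceRight_mem f hx.1
  have hess : ∀ x : D.carrier, sliceLeft (D.vertexFunctional a) x = x → x ≠ 0 →
      ∃ f : D.carrier →ₗ[k] k, sliceRight f x = ⟨n, hnD⟩ := by
    intro x hx hx0
    have hx' := congrArg Subtype.val hx
    rw [coe_sliceLeft_vertexFunctional] at hx'
    obtain ⟨f, hf⟩ := exists_sliceRight_eq_of_nil (fun h => hx0 (Subtype.ext h))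
      (sliceLeft_vertexCoeff_eq_self.1 hx')
    exact ⟨f ∘ₗ D.carrier.subtype, Subtype.ext ((coe_sliceRight D f x).trans hf)⟩
  have hidem : ∀ x, sliceLeft (D.vertexFunctional a) (sliceLeft (D.vertexFunctional a) x) =
      sliceLeft (D.vertexFunctional a) x := by
    intro x
    refine Subtype.ext ?_
    simp only [coe_sliceLeft_vertexFunctional, sliceLeft_vertexCoeff_idem]
  have hcounit : Coalgebra.counit (R := k) (⟨n, hnD⟩ : D.carrier) = 1 := by
    change Coalgebra.counit (R := k) n = 1
    rw [hn, counit_of]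
    simp
  refine ⟨not_leftSemiperfect_of_slice _ hidem ⟨n, hnD⟩ ?_ hcounit ?_ hess hinf,
    not_leftQuasiCoFrobenius_of_slice _ ⟨n, hnD⟩ ?_ ?_ hinf⟩
  · apply tensor_subtype_injective k D.carrier
    exact (LinearMap.congr_fun D.isSubcoalgebra.map_comul ⟨n, hnD⟩).trans (comul_of_nil a)
  · refine Subtype.ext ?_
    rw [coe_sliceLeft_vertexFunctional, sliceLeft_vertexCoeff_eq_self]
    intro p hp
    classical
    rw [mem_support] at hp
    change coeffAt k p (of k _) ≠ 0 at hp
    rw [coeffAt_of] at hp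
    by_contra hne
    rw [if_neg (by rintro rfl; exact hne rfl)] at hp
    exact hp rfl
  · intro h
    rw [h, map_zero] at hcounit
    exact zero_ne_one hcounit
  · rintro _ ⟨y, rfl⟩ hx0
    exact hess _ (hidem y) hx0

end Subcoalgebra

theorem Quiver.Path.factorizations_cons {V : Type u} [Quiver.{u} V] {a b c : V}
    (p : Quiver.Path a b) (e : b ⟶ c) : (p.cons e).factorizations =
      ⟨_, p.cons e, nil⟩ :: p.factorizations.map fun s => ⟨s.1, s.2.1, s.2.2.cons e⟩ := rfl

/-! ### Path coalgebras and embeddings of quivers -/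

section Embedding

variable {k : Type u} [Field k] {V W : Type u} [Quiver.{u} V] [Quiver.{u} W]

theorem Prefunctor.mapPath_injective_of {φ : Prefunctor V W} (hobj : Function.Injective φ.obj)
    (hmap : ∀ a b : V, Function.Injective (φ.map : (a ⟶ b) → _)) {a : V} :
    ∀ {c : V} (p q : Quiver.Path a c), φ.mapPath p = φ.mapPath q → p = q
  | _, .nil, .nil, _ => rfl
  | _, .nil, .cons q e, h => absurd h.symm (Quiver.Path.cons_ne_nil _ _)
  | _, .cons p e, .nil, h => absurd h (Quiver.Path.cons_ne_nil _ _)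
  | _, .cons (b := b) p e, .cons (b := b') q e', h => by
    have hb : b = b' := hobj (Quiver.Path.obj_eq_of_cons_eq_cons h)
    subst hb
    have h1 := eq_of_heq (Quiver.Path.heq_of_cons_eq_cons h)
    have h2 := eq_of_heq (Quiver.Path.hom_heq_of_cons_eq_cons h)
    rw [mapPath_injective_of hobj hmap p q h1, hmap _ _ h2]

namespace PathCoalgebra

theorem pushForward_of (φ : Prefunctor V W) {a b : V} (p : Quiver.Path a b) :
    pushForward φ (of k p) = of k (φ.mapPath p) := lift_of _ p

/-- Injectivity on vertices and arrows means that a path of the larger quiver is the image of at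
most one path. -/
theorem coeffAt_pushForward {φ : Prefunctor V W} (hobj : Function.Injective φ.obj)
    (hmap : ∀ a b : V, Function.Injective (φ.map : (a ⟶ b) → _)) {a b : V}
    (p : Quiver.Path a b) :
    coeffAt k ⟨φ.obj a, φ.obj b, φ.mapPath p⟩ ∘ₗ pushForward φ = coeffAt k ⟨a, b, p⟩ := by
  classical
  refine hom_ext fun {a' b'} q => ?_
  rw [LinearMap.comp_apply, pushForward_of, coeffAt_of, coeffAt_of]
  refine if_congr ⟨fun h => ?_, fun h => ?_⟩ rfl rfl
  · obtain ⟨h1, h2, h3⟩ := AnyPath.mk.inj h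
    have h1 := hobj h1
    have h2 := hobj h2
    subst h1
    subst h2
    rw [φ.mapPath_injective_of hobj hmap _ _ (eq_of_heq h3)]
  · cases h
    rfl

theorem pushForward_injective {φ : Prefunctor V W} (hobj : Function.Injective φ.obj)
    (hmap : ∀ a b : V, Function.Injective (φ.map : (a ⟶ b) → _)) :
    Function.Injective (pushForward (k := k) φ) := by
  intro x y h
  refine ext_coeffAt fun p => ?_
  have := LinearMap.congr_fun (coeffAt_pushForward (k := k) hobj hmap p.path)
  rw [← this, ← this, LinearMap.comp_apply, LinearMap.comp_apply, h]

theorem exists_functional_pushForward {φ : Prefunctor V W} (hobj : Function.Injective φ.obj)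
    (hmap : ∀ a b : V, Function.Injective (φ.map : (a ⟶ b) → _)) (f : PathCoalgebra k V →ₗ[k] k) :
    ∃ g : PathCoalgebra k W →ₗ[k] k, g ∘ₗ pushForward φ = f :=
  LinearMap.exists_comp_eq_of_ker_le _ _
    (by rw [LinearMap.ker_eq_bot.2 (pushForward_injective hobj hmap)]; exact bot_le)

theorem eq_sum_support (x : PathCoalgebra k V) :
    x = ∑ p ∈ x.support, coeffAt k p x • of k p.path := by
  conv_lhs => rw [← Finsupp.sum_single x]
  refine Finset.sum_congr rfl fun p _ => ?_
  unfold of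
  exact (Finsupp.smul_single_one p _).symm

/-- Linear maps that agree on the paths that occur in `x` agree on `x`. -/
theorem map_eq_of_support {M : Type*} [AddCommGroup M] [Module k M]
    {f g : PathCoalgebra k V →ₗ[k] M} {x : PathCoalgebra k V}
    (h : ∀ p ∈ x.support, f (of k p.path) = g (of k p.path)) : f x = g x := by
  rw [eq_sum_support x, map_sum, map_sum]
  exact Finset.sum_congr rfl fun p hp => by rw [map_smul, map_smul, h p hp]

end PathCoalgebra

end Embedding

/-! ### One step of the tail construction -/

section TailExtension

open PathCoalgebra

variable {k : Type u} [Field k] {V : Type u} [Quiver.{u} V]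

namespace IndependentSet

variable {C : Subcoalgebra k (PathCoalgebra k V)} (F : IndependentSet C)

/-- The arrow `α_{p,F}`. -/
def arrow (p : F.elems) {a : V} (h : EndsAt (p : PathCoalgebra k V) a) :
    (TailVertex.inclusion C).obj a ⟶ TailVertex.new F := ⟨p, h⟩

open Classical in
/-- The map `q ↦ q α_{p,F}`. -/
noncomputable def appendArrow (p : F.elems) :
    PathCoalgebra k V →ₗ[k] PathCoalgebra k (TailVertex C) :=
  PathCoalgebra.lift k (fun {a b} (q : Quiver.Path a b) =>
    if h : EndsAt (p : PathCoalgebra k V) b then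
      PathCoalgebra.of k (((TailVertex.inclusion C).mapPath q).cons (F.arrow p h))
    else 0)

theorem tailTerm_eq (p : F.elems) : F.tailTerm p = F.appendArrow p p := rfl

theorem appendArrow_of {p : F.elems} {a b : V} (h : EndsAt (p : PathCoalgebra k V) b)
    (q : Quiver.Path a b) : F.appendArrow p (of k q) =
      of k (((TailVertex.inclusion C).mapPath q).cons (F.arrow p h)) :=
  (lift_of _ q).trans (dif_pos h)

theorem appendArrow_of_not {p : F.elems} {a b : V} (h : ¬ EndsAt (p : PathCoalgebra k V) b)
    (q : Quiver.Path a b) : F.appendArrow p (of k q) = 0 :=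
  (lift_of _ q).trans (dif_neg h)

/-- A factorization of `q α` either leaves the trivial path at `e_F` on the right, or is `x · (y α)`
with `x y = q`. The two terms correspond to these two cases. -/
theorem sliceRight_appendArrow (p : F.elems) (g : PathCoalgebra k (TailVertex C) →ₗ[k] k)
    (x : PathCoalgebra k V) : sliceRight g (F.appendArrow p x) =
      g (of k (Quiver.Path.nil : Quiver.Path (TailVertex.new F) _)) • F.appendArrow p x +
      pushForward (TailVertex.inclusion C) (sliceRight (g ∘ₗ F.appendArrow p) x) := by
  suffices h : sliceRight g ∘ₗ F.appendArrow p =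
      g (of k (Quiver.Path.nil : Quiver.Path (TailVertex.new F) _)) • F.appendArrow p +
      pushForward (TailVertex.inclusion C) ∘ₗ sliceRight (g ∘ₗ F.appendArrow p) from
    LinearMap.congr_fun h x
  refine hom_ext fun {a b} q => ?_
  simp only [LinearMap.comp_apply, LinearMap.add_apply, LinearMap.smul_apply]
  rw [sliceRight_of, map_list_sum, List.map_map]
  by_cases h : EndsAt (p : PathCoalgebra k V) b
  · rw [appendArrow_of F h, sliceRight_of, Quiver.Path.factorizations_cons]
    rw [List.map_cons, List.sum_cons]
    congr 1
    rw [Quiver.Path.factorizations_mapPath, List.map_map, List.map_map]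
    refine congrArg List.sum (List.map_congr_left fun s _ => ?_)
    simp only [Function.comp_apply, map_smul, LinearMap.comp_apply, pushForward_of]
    rw [appendArrow_of F h]
  · rw [appendArrow_of_not F h, map_zero, smul_zero, zero_add]
    symm
    apply List.sum_eq_zero
    intro t ht
    obtain ⟨s, _, rfl⟩ := List.mem_map.1 ht
    simp only [Function.comp_apply, map_smul, LinearMap.comp_apply]
    rw [appendArrow_of_not F h, map_zero, zero_smul]

/-- Shows that `g ⇀ q_F` is a multiple of `q_F` plus an element of `C`, so the left action creates
nothing new. -/
theorem sliceRight_tail (g : PathCoalgebra k (TailVertex C) →ₗ[k] k) : sliceRight g F.tail =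
      g (of k (Quiver.Path.nil : Quiver.Path (TailVertex.new F) _)) • F.tail +
      ∑ p : F.elems, pushForward (TailVertex.inclusion C)
        (sliceRight (g ∘ₗ F.appendArrow p) (p : PathCoalgebra k V)) := by
  simp only [tail, map_sum, tailTerm_eq, sliceRight_appendArrow, Finset.sum_add_distrib,
    Finset.smul_sum]

theorem sliceRight_vertexCoeff_tail :
    sliceRight (vertexCoeff k (TailVertex.new F)) F.tail = F.tail := by
  classical
  -- A path `q α` starts at an old vertex, so it is never the trivial path at `e_F`.
  have h : ∀ p : F.elems, vertexCoeff k (TailVertex.new F) ∘ₗ F.appendArrow p = 0 := by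
    intro p
    refine hom_ext fun {a b} q => ?_
    rw [LinearMap.comp_apply, LinearMap.zero_apply]
    by_cases h : EndsAt (p : PathCoalgebra k V) b
    · rw [appendArrow_of F h, vertexCoeff, coeffAt_of, if_neg]
      intro h1
      have := congrArg AnyPath.src h1
      cases this
    · rw [appendArrow_of_not F h, map_zero]
  rw [sliceRight_tail]
  simp only [h]
  rw [vertexCoeff, coeffAt_of, if_pos rfl, one_smul]
  simp [sliceRight_apply]

/-- The elements of an independent set can be recovered from its tail. -/
theorem exists_sliceRight_tail_eq (p : F.elems) :
    ∃ g : PathCoalgebra k (TailVertex C) →ₗ[k] k,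
      sliceRight g F.tail = pushForward (TailVertex.inclusion C) (p : PathCoalgebra k V) := by
  classical
  -- The indicator of the arrow `α_{p,F}`, as a path of length one. It ignores the other arrows of
  -- `F`, and `g (q α_{p,F})` is the counit of `q` for `q` ending at `t(p)`. Hence it strips the
  -- arrow from `q_F` and leaves `p`.
  let g : PathCoalgebra k (TailVertex C) →ₗ[k] k := lift k fun {x y} q =>
    if ∃ (a : V) (h : EndsAt (p : PathCoalgebra k V) a), (⟨x, y, q⟩ : AnyPath (TailVertex C)) =
      ⟨(TailVertex.inclusion C).obj a, TailVertex.new F,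
        Quiver.Path.nil.cons (F.arrow p h)⟩ then 1 else 0
  have hg : ∀ {x y : TailVertex C} (q : Quiver.Path x y), g (of k q) =
      if ∃ (a : V) (h : EndsAt (p : PathCoalgebra k V) a), (⟨x, y, q⟩ : AnyPath (TailVertex C)) =
      ⟨(TailVertex.inclusion C).obj a, TailVertex.new F,
        Quiver.Path.nil.cons (F.arrow p h)⟩ then 1 else 0 :=
    fun q => lift_of _ q
  refine ⟨g, ?_⟩
  have h0 : g (of k (Quiver.Path.nil : Quiver.Path (TailVertex.new F) _)) = 0 := by
    rw [hg, if_neg]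
    rintro ⟨a, h, h1⟩
    have := congrArg AnyPath.src h1
    cases this
  have h1 : ∀ p' : F.elems, p' ≠ p → g ∘ₗ F.appendArrow p' = 0 := by
    intro p' hne
    refine hom_ext fun {a b} q => ?_
    rw [LinearMap.comp_apply, LinearMap.zero_apply]
    by_cases h : EndsAt (p' : PathCoalgebra k V) b
    · rw [appendArrow_of F h, hg, if_neg]
      rintro ⟨c, hc, h2⟩
      obtain ⟨h3, -, h4⟩ := AnyPath.mk.inj h2
      cases h3
      have h5 := eq_of_heq h4
      have h6 := Quiver.Path.obj_eq_of_cons_eq_cons h5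
      cases h6
      have h7 := eq_of_heq (Quiver.Path.hom_heq_of_cons_eq_cons h5)
      exact hne (congrArg Subtype.val h7)
    · rw [appendArrow_of_not F h, map_zero]
  have h2 : ∀ {a b : V} (q : Quiver.Path a b), EndsAt (p : PathCoalgebra k V) b →
      g (F.appendArrow p (of k q)) = if q.length = 0 then 1 else 0 := by
    intro a b q h
    rw [appendArrow_of F h, hg]
    refine if_congr ⟨?_, fun hq => ?_⟩ rfl rfl
    · rintro ⟨c, hc, h2⟩
      obtain ⟨h3, -, h4⟩ := AnyPath.mk.inj h2
      cases h3
      have h5 := eq_of_heq h4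
      have h6 := Quiver.Path.obj_eq_of_cons_eq_cons h5
      cases h6
      have h7 := congrArg Quiver.Path.length (eq_of_heq (Quiver.Path.heq_of_cons_eq_cons h5))
      cases q with
      | nil => rfl
      | cons q e => exact absurd h7 (Nat.succ_ne_zero _)
    · cases q with
      | nil => exact ⟨a, h, rfl⟩
      | cons q e => exact absurd hq (Nat.succ_ne_zero _)
  have h3 : sliceRight (g ∘ₗ F.appendArrow p) (p : PathCoalgebra k V) = p := by
    refine map_eq_of_support (g := LinearMap.id) fun q hq => ?_
    obtain ⟨a, b, hab⟩ := F.isMultipath p p.2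
    have hend : EndsAt (p : PathCoalgebra k V) q.tgt := fun r hr => by
      rw [(hab r hr).2, (hab q hq).2]
    rw [sliceRight_of, LinearMap.id_apply]
    simp only [LinearMap.comp_apply, h2 _ hend]
    exact sum_counit_right q.path fun b y => of k y
  rw [sliceRight_tail, h0, zero_smul, zero_add, Finset.sum_eq_single p, h3]
  · intro p' _ hne
    rw [h1 p' hne]
    simp [sliceRight_apply]
  · intro h
    exact absurd (Finset.mem_univ p) h

end IndependentSet

/-- The elements of the tail extension are sums of an element of `C` and of elements `q_F ↼ f`. -/
theorem tailExtension_le (C : Subcoalgebra k (PathCoalgebra k V)) :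
    (tailExtension C).carrier ≤ C.carrier.map (pushForward (TailVertex.inclusion C)) ⊔
      ⨆ F : IndependentSet C, LinearMap.range (leftOrbit F.tail) := by
  have hC := C.isSubcoalgebra.map _ (pushForward_comul (k := k) (TailVertex.inclusion C))
  set U : Submodule k (PathCoalgebra k (TailVertex C)) :=
    C.carrier.map (pushForward (TailVertex.inclusion C)) ⊔
      ⨆ F : IndependentSet C, LinearMap.range (leftOrbit F.tail)
  -- The right-hand side contains the generators, so it suffices that it is stable under both
  -- actions.
  refine sInf_le ⟨isSubcoalgebra_of_slices (fun g => ?_) (fun g => ?_), ?_⟩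
  · suffices h : U ≤ Submodule.comap (sliceRight g) U from fun x hx => h hx
    refine sup_le (fun x hx => Submodule.mem_sup_left (hC.sliceRight_mem g hx))
      (iSup_le fun F => ?_)
    rintro _ ⟨f, rfl⟩
    rw [Submodule.mem_comap, leftOrbit_apply, sliceRight_sliceLeft, F.sliceRight_tail, map_add,
      map_smul, map_sum, add_comm]
    refine Submodule.add_mem_sup (Submodule.sum_mem _ fun p _ => ?_)
      (Submodule.smul_mem _ _ (Submodule.mem_iSup_of_mem F ⟨f, rfl⟩))
    exact hC.sliceLeft_mem f (Submodule.mem_map_of_mem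
      (C.isSubcoalgebra.sliceRight_mem _ (F.mem_coalgebra p p.2)))
  · suffices h : U ≤ Submodule.comap (sliceLeft g) U from fun x hx => h hx
    refine sup_le (fun x hx => Submodule.mem_sup_left (hC.sliceLeft_mem g hx))
      (iSup_le fun F => ?_)
    rintro _ ⟨f, rfl⟩
    rw [Submodule.mem_comap, leftOrbit_apply, sliceLeft_sliceLeft]
    exact Submodule.mem_sup_right (Submodule.mem_iSup_of_mem F ⟨_, rfl⟩)
  · rintro _ (⟨x, hx, rfl⟩ | ⟨F, rfl⟩)
    · exact Submodule.mem_sup_left (Submodule.mem_map_of_mem hx)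
    · refine Submodule.mem_sup_right (Submodule.mem_iSup_of_mem F ⟨Coalgebra.counit, ?_⟩)
      rw [leftOrbit_apply, sliceLeft_counit]

theorem pushForward_mem_tailExtension {C : Subcoalgebra k (PathCoalgebra k V)}
    {x : PathCoalgebra k V} (hx : x ∈ C.carrier) :
    pushForward (TailVertex.inclusion C) x ∈ (tailExtension C).carrier :=
  Submodule.mem_sInf.2 fun _ hD => hD.2 (Or.inl ⟨x, hx, rfl⟩)

theorem IndependentSet.tail_mem {C : Subcoalgebra k (PathCoalgebra k V)} (F : IndependentSet C) :
    F.tail ∈ (tailExtension C).carrier :=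
  Submodule.mem_sInf.2 fun _ hD => hD.2 (Or.inr ⟨F, rfl⟩)

end TailExtension

/-! ### Right coideals and independent generating sets -/

section RightCoideals

variable {k : Type u} [Field k] {A : Type u} [AddCommGroup A] [Module k A]

/-- A tensor whose slices lie in `I` and in `D` lies in `I ⊗ D`. -/
theorem mem_range_map_of_slices (I D : Submodule k A) (t : A ⊗[k] A)
    (h1 : ∀ f : A →ₗ[k] k, TensorProduct.lid k A (f.rTensor A t) ∈ D)
    (h2 : ∀ f : A →ₗ[k] k, TensorProduct.rid k A (f.lTensor A t) ∈ I) :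
    t ∈ LinearMap.range (TensorProduct.map I.subtype D.subtype) := by
  classical
  have hproj : ∀ E : Submodule k A, ∃ π : A →ₗ[k] E, ∀ x ∈ E, E.subtype (π x) = x := by
    intro E
    obtain ⟨q, hq⟩ := E.exists_isCompl
    exact ⟨E.projectionOnto q hq, fun x hx =>
      congrArg Subtype.val (Submodule.projectionOnto_apply_left hq ⟨x, hx⟩)⟩
  obtain ⟨π, hπ⟩ := hproj D
  obtain ⟨ρ, hρ⟩ := hproj I
  let b := Module.Basis.ofVectorSpace k A
  have r1 : (D.subtype ∘ₗ π).lTensor A t = t := by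
    apply (TensorProduct.equivFinsuppOfBasisLeft b).injective
    ext i
    rw [TensorProduct.equivFinsuppOfBasisLeft_apply, TensorProduct.equivFinsuppOfBasisLeft_apply]
    have e : ∀ s : A ⊗[k] A, TensorProduct.lid k A ((b.coord i).rTensor A
        ((D.subtype ∘ₗ π).lTensor A s)) =
        D.subtype (π (TensorProduct.lid k A ((b.coord i).rTensor A s))) := by
      intro s
      induction s with
      | zero => simp
      | tmul a b => simp
      | add a b ha hb => simp only [map_add, ha, hb]
    rw [e, hπ _ (h1 _)]
  have r2 : (I.subtype ∘ₗ ρ).rTensor A t = t := by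
    apply (TensorProduct.equivFinsuppOfBasisRight b).injective
    ext i
    rw [TensorProduct.equivFinsuppOfBasisRight_apply, TensorProduct.equivFinsuppOfBasisRight_apply]
    have e : ∀ s : A ⊗[k] A, TensorProduct.rid k A ((b.coord i).lTensor A
        ((I.subtype ∘ₗ ρ).rTensor A s)) =
        I.subtype (ρ (TensorProduct.rid k A ((b.coord i).lTensor A s))) := by
      intro s
      induction s with
      | zero => simp
      | tmul a b => simp
      | add a b ha hb => simp only [map_add, ha, hb]
    rw [e, hρ _ (h2 _)]
  refine ⟨TensorProduct.map ρ π t, ?_⟩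
  conv_rhs => rw [← r2, ← r1]
  rw [← LinearMap.comp_apply, ← LinearMap.comp_apply, ← TensorProduct.map_comp,
    LinearMap.rTensor_comp_lTensor]

variable [Coalgebra k A]

/-- The right coideal generated by `x` is contained in every subspace that contains `x` and is
closed under the actions of functionals. -/
theorem rightCoidealGenerated_le {C : Subcoalgebra k A} {x : A} (hx : x ∈ C.carrier)
    {N : Submodule k A} (hxN : x ∈ N) (hN : ∀ f : A →ₗ[k] k, ∀ y ∈ N, sliceRight f y ∈ N) :
    rightCoidealGenerated C x ≤ N := by
  -- `N` need not lie in `C`, so the coideal to compare with is its intersection with `C`.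
  have h : IsRightCoideal C (N ⊓ C.carrier) := ⟨inf_le_right, fun y hy =>
    mem_range_map_of_slices _ _ _ (fun f => C.isSubcoalgebra.sliceLeft_mem f hy.2)
      fun f => ⟨hN f y hy.1, C.isSubcoalgebra.sliceRight_mem f hy.2⟩⟩
  exact fun y hy => (Submodule.mem_sInf.1 hy (N ⊓ C.carrier) ⟨h, hxN, hx⟩).1

end RightCoideals

section Generators

variable {k : Type u} [Field k] {V : Type u} [Quiver.{u} V]

open PathCoalgebra

/-- `S` generates `M` as a right coideal. -/
def GeneratesRightCoideal (S : Finset (PathCoalgebra k V))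
    (M : Submodule k (PathCoalgebra k V)) : Prop :=
  ∀ N : Submodule k (PathCoalgebra k V), (∀ f : PathCoalgebra k V →ₗ[k] k, ∀ y ∈ N,
    sliceRight f y ∈ N) → (∀ p ∈ S, p ∈ N) → M ≤ N

/-- Sorts the paths of `x` by their targets. For an `x` with a single source the summands are
multipaths. -/
theorem sum_sliceRight_vertexCoeff (x : PathCoalgebra k V) : ∃ S : Finset V,
    x = ∑ b ∈ S, sliceRight (vertexCoeff k b) x := by
  classical
  refine ⟨x.support.image AnyPath.tgt, ext_coeffAt fun p => ?_⟩
  simp only [map_sum, coeffAt_sliceRight_vertexCoeff, Finset.sum_ite_eq]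
  split_ifs with h
  · rfl
  · by_contra h1
    exact h (Finset.mem_image_of_mem _ (mem_support.2 h1))

/-- A finite dimensional right coideal whose elements are combinations of paths with one source is
generated by an independent set of multipaths. -/
theorem exists_independentSet_generates (C : Subcoalgebra k (PathCoalgebra k V))
    (M : Submodule k (PathCoalgebra k V)) [FiniteDimensional k M] (hMC : M ≤ C.carrier)
    (hMa : ∀ x ∈ M, ∀ p ∈ x.support, ∀ q ∈ x.support, p.src = q.src)
    (hM : ∀ f : PathCoalgebra k V →ₗ[k] k, ∀ m ∈ M, sliceRight f m ∈ M) :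
    ∃ F : IndependentSet C, GeneratesRightCoideal F.elems M := by
  classical
  let good : Finset (PathCoalgebra k V) → Prop := fun S =>
    (∀ x ∈ S, x ∈ M ∧ IsMultipath x) ∧ GeneratesRightCoideal S M
  -- Cut a finite spanning set of `M` by targets; the pieces stay in `M` because `M` is closed under
  -- the left action.
  have hex : ∃ S, good S := by
    obtain ⟨T, hT⟩ := (Submodule.fg_iff_finiteDimensional M).2 inferInstance
    choose B hB using sum_sliceRight_vertexCoeff (k := k) (V := V)
    have hTM : ∀ t ∈ T, t ∈ M := fun t ht => hT ▸ Submodule.subset_span ht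
    refine ⟨T.biUnion fun t => (B t).image fun b => sliceRight (vertexCoeff k b) t, ?_, ?_⟩
    · intro x hx
      obtain ⟨t, ht, hx⟩ := Finset.mem_biUnion.1 hx
      obtain ⟨b, hb, rfl⟩ := Finset.mem_image.1 hx
      have hxM := hM (vertexCoeff k b) t (hTM t ht)
      refine ⟨hxM, ?_⟩
      rcases (sliceRight (vertexCoeff k b) t).support.eq_empty_or_nonempty with h0 | ⟨q, hq⟩
      · exact ⟨b, b, fun p hp => by simp [h0] at hp⟩
      refine ⟨q.src, b, fun p hp => ⟨hMa _ hxM p hp q hq, ?_⟩⟩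
      rw [mem_support, coeffAt_sliceRight_vertexCoeff] at hp
      by_contra hne
      exact hp (if_neg hne)
    · intro N _ hSN
      rw [← hT, Submodule.span_le]
      intro t ht
      rw [SetLike.mem_coe, hB t]
      exact Submodule.sum_mem _ fun b hb => hSN _ (Finset.mem_biUnion.2
        ⟨t, ht, Finset.mem_image_of_mem _ hb⟩)
  -- Minimal cardinality is the source of independence: no element lies in the closed subspace
  -- generated by the others. A linear relation, or a second element of `S` in the coideal generated
  -- by `x`, would make some element superfluous.
  obtain ⟨S, hS, hmin⟩ := exists_minimalFor_of_wellFoundedLT good Finset.card hex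
  have hirr : ∀ x ∈ S, ¬ ∀ N : Submodule k (PathCoalgebra k V),
      (∀ f : PathCoalgebra k V →ₗ[k] k, ∀ y ∈ N, sliceRight f y ∈ N) →
      (∀ p ∈ S.erase x, p ∈ N) → x ∈ N := by
    intro x hx h
    have hcard := Finset.card_erase_lt_of_mem hx
    refine absurd (hmin (j := S.erase x) ⟨fun y hy => hS.1 y (Finset.mem_of_mem_erase hy), ?_⟩
      hcard.le) (not_le.2 hcard)
    intro N hN hSN
    refine hS.2 N hN fun p hp => ?_
    by_cases hpx : p = x
    · exact hpx ▸ h N hN hSN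
    · exact hSN p (Finset.mem_erase.2 ⟨hpx, hp⟩)
  refine ⟨⟨S, fun x hx => hMC (hS.1 x hx).1, fun x hx => (hS.1 x hx).2, ?_, ?_⟩, hS.2⟩
  · rw [linearIndependent_iff_notMem_span]
    intro x hx
    refine hirr x x.2 fun N _ hSN => ?_
    refine Submodule.span_le.2 ?_ hx
    rintro _ ⟨y, hy, rfl⟩
    exact hSN y (Finset.mem_erase.2 ⟨fun h => hy.2 (Subtype.ext h), y.2⟩)
  · intro x hx
    refine Set.Subset.antisymm ?_ ?_
    · rintro y ⟨hy, hyS⟩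
      by_contra hne
      refine hirr y hyS fun N hN hSN => ?_
      exact rightCoidealGenerated_le (hMC (hS.1 x hx).1)
        (hSN x (Finset.mem_erase.2 ⟨fun h => hne h.symm, hx⟩)) hN hy
    · rintro _ rfl
      exact ⟨Submodule.mem_sInf.2 fun _ hI => hI.2, hx⟩

end Generators

open PathCoalgebra

/-! ### The stages inside the union, and the elements that end at a new vertex -/

section Closure

variable {k : Type u} [Field k] {V : Type u} [Quiver.{u} V]
  {C : Subcoalgebra k (PathCoalgebra k V)}

namespace TailClosureVertex

/-- A vertex of a stage, seen in a later stage, is not one of the vertices added there or later. -/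
theorem ofStage_ne_new : ∀ (n m : ℕ) (_ : n ≤ m) (v : (tailStage C n).vertices)
    (F : IndependentSet (tailStage C m).coalgebra), ofStage C n v ≠ new m F
  | 0, _, _, _, _ => fun h => by cases h
  | n + 1, m, h, v, F => by
    change TailVertex (tailStage C n).coalgebra at v
    cases v with
    | old v => exact ofStage_ne_new n m (by omega) v F
    | new G =>
      intro h1
      have h2 : new n G = new m F := h1
      injection h2
      omega

/-- Each added vertex remembers the stage at which it was added, so it differs from all vertices of
earlier stages. -/
theorem ofStage_injective : ∀ n : ℕ, Function.Injective (ofStage C n)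
  | 0 => fun _ _ h => by
    injection h
  | n + 1 => by
    intro x y h
    change TailVertex (tailStage C n).coalgebra at x y
    cases x with
    | old v =>
      cases y with
      | old w => exact congrArg TailVertex.old (ofStage_injective n h)
      | new G => exact absurd h (ofStage_ne_new n n le_rfl v G)
    | new F =>
      cases y with
      | old w => exact absurd h.symm (ofStage_ne_new n n le_rfl w F)
      | new G =>
        have h1 : new n F = new n G := h
        injection h1 with h2 h3
        exact congrArg TailVertex.new h3

theorem ofStageArrow_injective : ∀ (n : ℕ) (x y : (tailStage C n).vertices),
    Function.Injective (ofStageArrow C n : (x ⟶ y) → _)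
  | 0, _, _ => fun _ _ h => h
  | n + 1, x, y => by
    intro e e' h
    change TailVertex (tailStage C n).coalgebra at x y
    cases x with
    | old v =>
      cases y with
      | old w => exact ofStageArrow_injective n v w h
      | new G =>
        exact Subtype.ext (congrArg (fun t : {p : G.elems // ∃ w : (tailStage C n).vertices,
          ofStage C n w = ofStage C n v ∧
            EndsAt (p : PathCoalgebra k (tailStage C n).vertices) w} => t.1) h)
    | new F => cases y <;> exact e.elim

end TailClosureVertex

open TailClosureVertex

variable (C) in
/-- The embedding of the path coalgebra of a stage into that of the union. -/
noncomputable def stageMap (n : ℕ) : PathCoalgebra k (tailStage C n).vertices →ₗ[k]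
    PathCoalgebra k (TailClosureVertex C) := pushForward (stageInclusion C n)

theorem stageMap_comul (n : ℕ) : TensorProduct.map (stageMap C n) (stageMap C n) ∘ₗ
    Coalgebra.comul = Coalgebra.comul ∘ₗ stageMap C n := pushForward_comul _

theorem stageMap_injective (n : ℕ) : Function.Injective (stageMap C n) :=
  pushForward_injective (ofStage_injective n) (ofStageArrow_injective n)

/-- The embedding is injective over a field, so functionals extend. Thus the actions of the
functionals on a stage are those of functionals on the union. -/
theorem exists_functional_stageMap (n : ℕ)
    (f : PathCoalgebra k (tailStage C n).vertices →ₗ[k] k) :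
    ∃ g : PathCoalgebra k (TailClosureVertex C) →ₗ[k] k, g ∘ₗ stageMap C n = f :=
  exists_functional_pushForward (ofStage_injective n) (ofStageArrow_injective n) f

theorem vertexCoeff_stageMap (n : ℕ) (v : (tailStage C n).vertices) :
    vertexCoeff k (ofStage C n v) ∘ₗ stageMap C n = vertexCoeff k v :=
  coeffAt_pushForward (φ := stageInclusion C n) (ofStage_injective n) (ofStageArrow_injective n)
    Quiver.Path.nil

theorem stageInclusion_mapPath_inclusion (n : ℕ) {a b : (tailStage C n).vertices}
    (p : Quiver.Path a b) : (stageInclusion C (n + 1)).mapPath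
      ((TailVertex.inclusion (tailStage C n).coalgebra).mapPath p) =
      (stageInclusion C n).mapPath p := by
  induction p with
  | nil => rfl
  | cons p e ih =>
    exact congrArg (fun q => Quiver.Path.cons q ((stageInclusion C n).map e)) ih

variable (C) in
/-- The map `stageMap C (n + 1)`, as a map on the path coalgebra of the extended quiver. -/
noncomputable def extensionMap (n : ℕ) :
    PathCoalgebra k (TailVertex (tailStage C n).coalgebra) →ₗ[k]
      PathCoalgebra k (TailClosureVertex C) := stageMap C (n + 1)

theorem extensionMap_comul (n : ℕ) : TensorProduct.map (extensionMap C n) (extensionMap C n) ∘ₗ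
    Coalgebra.comul = Coalgebra.comul ∘ₗ extensionMap C n := stageMap_comul (n + 1)

theorem exists_functional_extensionMap (n : ℕ)
    (f : PathCoalgebra k (TailVertex (tailStage C n).coalgebra) →ₗ[k] k) :
    ∃ g : PathCoalgebra k (TailClosureVertex C) →ₗ[k] k, g ∘ₗ extensionMap C n = f :=
  exists_functional_stageMap (n + 1) f

theorem vertexCoeff_extensionMap (n : ℕ) (F : IndependentSet (tailStage C n).coalgebra) :
    vertexCoeff k (new n F) ∘ₗ extensionMap C n = vertexCoeff k (TailVertex.new F) :=
  vertexCoeff_stageMap (n + 1) (TailVertex.new F)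

theorem extensionMap_of (n : ℕ) {a b : TailVertex (tailStage C n).coalgebra}
    (p : Quiver.Path a b) : extensionMap C n (of k p) = of k ((stageInclusion C (n + 1)).mapPath p) :=
  pushForward_of (stageInclusion C (n + 1)) p

theorem extensionMap_pushForward (n : ℕ) (x : PathCoalgebra k (tailStage C n).vertices) :
    extensionMap C n (pushForward (TailVertex.inclusion (tailStage C n).coalgebra) x) =
      stageMap C n x := by
  suffices h : extensionMap C n ∘ₗ pushForward (TailVertex.inclusion (tailStage C n).coalgebra) =
      stageMap C n from LinearMap.congr_fun h x
  refine hom_ext fun {a b} p => ?_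
  rw [LinearMap.comp_apply, pushForward_of, extensionMap_of, stageMap, pushForward_of]
  exact congrArg (of k) (stageInclusion_mapPath_inclusion n p)

variable (C) in
/-- The image of a stage in the path coalgebra of the union. -/
noncomputable def stageImage (n : ℕ) : Submodule k (PathCoalgebra k (TailClosureVertex C)) :=
  (tailStage C n).coalgebra.carrier.map (stageMap C n)

theorem tailClosure_carrier : (tailClosure C).carrier = ⨆ n, stageImage C n := rfl

theorem stageImage_succ (n : ℕ) : stageImage C (n + 1) =
    (tailExtension (tailStage C n).coalgebra).carrier.map (extensionMap C n) := rfl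

theorem stageImage_le_tailClosure (n : ℕ) : stageImage C n ≤ (tailClosure C).carrier :=
  le_iSup (stageImage C) n

theorem stageImage_mono : Monotone (stageImage C) := by
  refine monotone_nat_of_le_succ fun n => ?_
  rintro _ ⟨x, hx, rfl⟩
  exact ⟨_, pushForward_mem_tailExtension hx, extensionMap_pushForward n x⟩

/-- The tail of an independent set, in the path coalgebra of the union. -/
noncomputable def tailElement (n : ℕ) (F : IndependentSet (tailStage C n).coalgebra) :
    PathCoalgebra k (TailClosureVertex C) := extensionMap C n F.tail

theorem tailElement_mem (n : ℕ) (F : IndependentSet (tailStage C n).coalgebra) :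
    tailElement n F ∈ (tailClosure C).carrier :=
  stageImage_le_tailClosure (n + 1) ⟨F.tail, F.tail_mem, rfl⟩

theorem sliceRight_vertexCoeff_tailElement (n : ℕ) (F : IndependentSet (tailStage C n).coalgebra) :
    sliceRight (vertexCoeff k (new n F)) (tailElement n F) = tailElement n F := by
  rw [tailElement, sliceRight_map _ (extensionMap_comul n)]
  rw [vertexCoeff_extensionMap, F.sliceRight_vertexCoeff_tail]

theorem exists_sliceRight_tailElement_eq (n : ℕ) (F : IndependentSet (tailStage C n).coalgebra)
    (p : F.elems) : ∃ g : PathCoalgebra k (TailClosureVertex C) →ₗ[k] k,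
      sliceRight g (tailElement n F) = stageMap C n p := by
  obtain ⟨g, hg⟩ := F.exists_sliceRight_tail_eq p
  obtain ⟨g', rfl⟩ := exists_functional_extensionMap n g
  refine ⟨g', ?_⟩
  rw [tailElement, sliceRight_map _ (extensionMap_comul n), hg,
    extensionMap_pushForward]

/-- The image of `tailExtension_le` in the union; functionals on the stage extend, so the orbits of
the tails are preserved. -/
theorem stageImage_succ_le (n : ℕ) : stageImage C (n + 1) ≤ stageImage C n ⊔
    ⨆ F : IndependentSet (tailStage C n).coalgebra, LinearMap.range (leftOrbit (tailElement n F)) := by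
  rw [stageImage_succ]
  refine (Submodule.map_mono (tailExtension_le (tailStage C n).coalgebra)).trans ?_
  rw [Submodule.map_sup, Submodule.map_iSup]
  refine sup_le_sup ?_ (iSup_mono fun F => ?_)
  · rintro _ ⟨_, ⟨x, hx, rfl⟩, rfl⟩
    exact ⟨x, hx, (extensionMap_pushForward n x).symm⟩
  · rintro _ ⟨_, ⟨f, rfl⟩, rfl⟩
    obtain ⟨g, rfl⟩ := exists_functional_extensionMap n f
    exact ⟨g, sliceLeft_map _ (extensionMap_comul n) g F.tail⟩

/-- The elements of `T(C)` that end at `e_F` are the elements `q_F ↼ f`. -/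
theorem exists_sliceRight_vertexCoeff_eq (n : ℕ) (F : IndependentSet (tailStage C n).coalgebra)
    {d : PathCoalgebra k (TailClosureVertex C)} (hd : d ∈ (tailClosure C).carrier) :
    ∃ f : PathCoalgebra k (TailClosureVertex C) →ₗ[k] k,
      sliceRight (vertexCoeff k (new n F)) d = sliceLeft f (tailElement n F) := by
  suffices h : (tailClosure C).carrier ≤ (LinearMap.range (leftOrbit (tailElement n F))).comap
      (sliceRight (vertexCoeff k (new n F))) by
    obtain ⟨f, hf⟩ := h hd
    exact ⟨f, hf.symm⟩
  rw [tailClosure_carrier]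
  refine iSup_le fun m => ?_
  -- Induction on the stage: passing from `m` to `m + 1` adds only elements `q_G ↼ f`, for
  -- independent sets `G` of stage `m`.
  induction m with
  | zero =>
    rintro _ ⟨x, -, rfl⟩
    rw [Submodule.mem_comap, sliceRight_map _ (stageMap_comul 0)]
    -- The vertex `e_F` does not belong to the original quiver.
    have h : vertexCoeff k (new n F) ∘ₗ stageMap C 0 = 0 := by
      classical
      refine hom_ext fun {a b} p => ?_
      rw [LinearMap.comp_apply, stageMap, pushForward_of, vertexCoeff, coeffAt_of, if_neg]
      · rfl
      · intro h
        exact ofStage_ne_new 0 n (Nat.zero_le n) a F (congrArg AnyPath.src h)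
    rw [h]
    simp [sliceRight_apply]
  | succ m ih =>
    refine (stageImage_succ_le m).trans (sup_le ih (iSup_le fun G => ?_))
    rintro _ ⟨f, rfl⟩
    rw [Submodule.mem_comap, leftOrbit_apply, sliceRight_sliceLeft]
    -- All paths of `q_G` end at `e_G`, so the projection to `e_F` fixes `q_G` if `G` is `F` and
    -- kills it otherwise.
    by_cases h : new (C := C) m G = new n F
    · injection h with h1 h2
      subst h1
      obtain rfl := eq_of_heq h2
      rw [sliceRight_vertexCoeff_tailElement]
      exact ⟨f, rfl⟩
    · have h1 := sliceRight_vertexCoeff_eq_self.1 (sliceRight_vertexCoeff_tailElement m G)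
      rw [sliceRight_vertexCoeff_eq_zero fun p hp => by rw [h1 p hp]; exact h, map_zero]
      exact zero_mem _

end Closure

open PathCoalgebra TailClosureVertex

/-! ### The tail closure generates and keeps its infinite pieces -/

section Closure

variable {k : Type u} [Field k] {V : Type u} [Quiver.{u} V]
  {C : Subcoalgebra k (PathCoalgebra k V)}

/-- The stages form an increasing chain, and a finite spanning set of `M` already lies in one of
them. -/
theorem exists_le_stageImage (M : Submodule k (PathCoalgebra k (TailClosureVertex C)))
    [FiniteDimensional k M] (hM : M ≤ (tailClosure C).carrier) : ∃ n, M ≤ stageImage C n := by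
  obtain ⟨T, hT⟩ := (Submodule.fg_iff_finiteDimensional M).2 inferInstance
  have h : ∀ t : T, ∃ n, (t : PathCoalgebra k (TailClosureVertex C)) ∈ stageImage C n := fun t =>
    (Submodule.mem_iSup_of_directed _ stageImage_mono.directed_le).1
      (hM (hT ▸ Submodule.subset_span t.2))
  choose n hn using h
  refine ⟨Finset.univ.sup n, ?_⟩
  rw [← hT, Submodule.span_le]
  exact fun t ht => stageImage_mono (Finset.le_sup (Finset.mem_univ ⟨t, ht⟩)) (hn ⟨t, ht⟩)

theorem support_stageMap {n : ℕ} {x : PathCoalgebra k (tailStage C n).vertices}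
    {p : AnyPath (tailStage C n).vertices} (hp : p ∈ x.support) :
    (⟨_, _, (stageInclusion C n).mapPath p.path⟩ : AnyPath (TailClosureVertex C)) ∈
      (stageMap C n x).support := by
  rw [mem_support] at hp ⊢
  have h := LinearMap.congr_fun (coeffAt_pushForward (k := k) (φ := stageInclusion C n)
    (ofStage_injective n) (ofStageArrow_injective n) p.path) x
  exact fun h0 => hp (h.symm.trans h0)

/-- Every finite dimensional right coideal of `T(C)` with a single source is generated by the image
of an independent set of a stage, so a functional that kills `q_F ↼ ·` kills the coideal. -/
theorem exists_tailElement_of_finiteDimensional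
    (M : Submodule k (PathCoalgebra k (TailClosureVertex C))) [FiniteDimensional k M]
    (hMC : M ≤ (tailClosure C).carrier) {a : TailClosureVertex C} (hMa : M ≤ withSource k a)
    (hM : ∀ f : PathCoalgebra k (TailClosureVertex C) →ₗ[k] k, ∀ m ∈ M, sliceRight f m ∈ M) :
    ∃ (n : ℕ) (F : IndependentSet (tailStage C n).coalgebra),
      ∀ f : PathCoalgebra k (TailClosureVertex C) →ₗ[k] k,
        sliceLeft f (tailElement n F) = 0 → ∀ m ∈ M, f m = 0 := by
  obtain ⟨n, hn⟩ := exists_le_stageImage M hMC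
  set N := M.comap (stageMap C n) with hN
  have hNM : ∀ x : N, stageMap C n x ∈ M := fun x => x.2
  have : FiniteDimensional k N := by
    refine Module.Finite.of_injective (((stageMap C n).comp N.subtype).codRestrict M hNM) ?_
    intro x y h
    exact Subtype.ext (stageMap_injective n (congrArg Subtype.val h))
  have hNC : N ≤ (tailStage C n).coalgebra.carrier := by
    intro x hx
    obtain ⟨y, hy, hxy⟩ := hn hx
    rwa [← stageMap_injective n hxy]
  -- The vertex `a` need not belong to stage `n`, so sources are only compared with each other.
  have hNa : ∀ x ∈ N, ∀ p ∈ x.support, ∀ q ∈ x.support, p.src = q.src := by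
    intro x hx p hp q hq
    have h := mem_withSource.1 (hMa hx)
    exact ofStage_injective n ((h _ (support_stageMap hp)).trans (h _ (support_stageMap hq)).symm)
  have hNR : ∀ f : PathCoalgebra k (tailStage C n).vertices →ₗ[k] k, ∀ m ∈ N,
      sliceRight f m ∈ N := by
    intro f m hm
    obtain ⟨g, rfl⟩ := exists_functional_stageMap n f
    rw [hN, Submodule.mem_comap, ← sliceRight_map _ (stageMap_comul n)]
    exact hM g _ hm
  obtain ⟨F, hF⟩ := exists_independentSet_generates _ N hNC hNa hNR
  refine ⟨n, F, fun f hf m hm => ?_⟩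
  -- The largest subspace of the stage that is closed under the left action and whose image is
  -- killed by `f`. If it contains `F`, it contains all of `N`.
  have key := hF (⨅ g : PathCoalgebra k (TailClosureVertex C) →ₗ[k] k,
    LinearMap.ker (f ∘ₗ sliceRight g ∘ₗ stageMap C n)) (fun l y hy => ?_) fun p hp => ?_
  · obtain ⟨y, -, rfl⟩ := hn hm
    have h := (Submodule.mem_iInf _).1 (key hm) Coalgebra.counit
    rwa [LinearMap.mem_ker, LinearMap.comp_apply, LinearMap.comp_apply, sliceRight_counit] at h
  · obtain ⟨l, rfl⟩ := exists_functional_stageMap n l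
    refine (Submodule.mem_iInf _).2 fun g => ?_
    rw [LinearMap.mem_ker, LinearMap.comp_apply, LinearMap.comp_apply,
      ← sliceRight_map _ (stageMap_comul n), sliceRight_sliceRight]
    exact (Submodule.mem_iInf _).1 hy _
  -- Since the image of `p` is `l ⇀ q_F`, the value `f (g ⇀ p)` is that of the convolution product
  -- `g * l` at `q_F ↼ f = 0`.
  · refine (Submodule.mem_iInf _).2 fun g => ?_
    obtain ⟨l, hl⟩ := exists_sliceRight_tailElement_eq n F ⟨p, hp⟩
    rw [LinearMap.mem_ker, LinearMap.comp_apply, LinearMap.comp_apply, ← hl,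
      sliceRight_sliceRight, apply_sliceRight, hf, map_zero]

/-- The tail closure of a subcoalgebra of a path coalgebra generates its left comodules. -/
theorem generatesLeftComodules_tailClosure (C : Subcoalgebra k (PathCoalgebra k V)) :
    GeneratesLeftComodules k (tailClosure C).carrier := by
  refine generatesLeftComodules_of_pieces (tailClosure C).vertexFunctional
    (tailClosure C).exists_counit_eq_sum fun a M _ hMa hM => ?_
  have hM' : ∀ f : PathCoalgebra k (TailClosureVertex C) →ₗ[k] k,
      ∀ m ∈ M.map (tailClosure C).carrier.subtype, sliceRight f m ∈ M.map (tailClosure C).carrier.subtype := by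
    rintro f _ ⟨m, hm, rfl⟩
    exact ⟨_, hM (f ∘ₗ (tailClosure C).carrier.subtype) m hm, coe_sliceRight (tailClosure C) f m⟩
  obtain ⟨n, F, hF⟩ := exists_tailElement_of_finiteDimensional (M.map (tailClosure C).carrier.subtype)
    (Submodule.map_subtype_le _ _) (a := a) (by
      refine (Submodule.map_mono hMa).trans ?_
      rw [Subcoalgebra.map_range_sliceLeft_vertexFunctional]
      exact inf_le_right) hM'
  -- Here `q` is `q_F` and `η` is the coefficient of the trivial path at `e_F`, which acts as the
  -- projection to the paths that end there.
  refine ⟨⟨tailElement n F, tailElement_mem n F⟩, (tailClosure C).vertexFunctional (new n F), ?_, fun d => ?_,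
    fun f hf m hm => ?_⟩
  · exact Subtype.ext ((coe_sliceRight (tailClosure C) _ _).trans (sliceRight_vertexCoeff_tailElement n F))
  · obtain ⟨f, hf⟩ := exists_sliceRight_vertexCoeff_eq n F d.2
    refine ⟨f ∘ₗ (tailClosure C).carrier.subtype, Subtype.ext ?_⟩
    rw [coe_sliceLeft, Subcoalgebra.vertexFunctional, coe_sliceRight]
    exact hf
  · obtain ⟨g, rfl⟩ := LinearMap.exists_extend f
    refine hF g ?_ _ (Submodule.mem_map_of_mem hm)
    have h := congrArg Subtype.val hf
    rw [coe_sliceLeft] at h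
    exact h

/-- The embedding of a stage is injective and respects sources, so it carries the piece at `a` into
the piece at the image of `a`. -/
theorem infinite_tailClosure (n : ℕ) (a : (tailStage C n).vertices)
    (h : ¬ FiniteDimensional k ((tailStage C n).coalgebra.carrier ⊓ withSource k a :
      Submodule k (PathCoalgebra k (tailStage C n).vertices))) :
    ¬ FiniteDimensional k ((tailClosure C).carrier ⊓ withSource k (ofStage C n a) :
      Submodule k (PathCoalgebra k (TailClosureVertex C))) := by
  intro hfin
  refine h (Module.Finite.of_injective (((stageMap C n).comp (Submodule.subtype _)).codRestrict
    ((tailClosure C).carrier ⊓ withSource k (ofStage C n a)) ?_) ?_)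
  · rintro ⟨x, hx, hxa⟩
    refine ⟨stageImage_le_tailClosure n ⟨x, hx, rfl⟩, stageMap C n x, ?_⟩
    rw [sliceLeft_map _ (stageMap_comul n), vertexCoeff_stageMap]
    exact congrArg _ (sliceLeft_vertexCoeff_eq_self.2 (mem_withSource.1 hxa))
  · intro x y hxy
    exact Subtype.ext (stageMap_injective n (congrArg Subtype.val hxy))

theorem tailClosure_properties (C : Subcoalgebra k (PathCoalgebra k V))
    (h : ¬ LeftSemiperfect k C.carrier) :
    GeneratesLeftComodules k (tailClosure C).carrier ∧
      ¬ LeftSemiperfect k (tailClosure C).carrier ∧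
      ¬ LeftQuasiCoFrobenius k (tailClosure C).carrier := by
  obtain ⟨a, ha⟩ := C.exists_infinite_of_not_leftSemiperfect h
  exact ⟨generatesLeftComodules_tailClosure C,
    (tailClosure C).not_leftSemiperfect_and_not_leftQuasiCoFrobenius (infinite_tailClosure 0 a ha)⟩

end Closure

/-! ### The quiver `A_∞` and the main theorem -/

/-- The path from the first vertex of `A_∞` to the vertex `n`. -/
def AInfinity.path : (n : ℕ) → Quiver.Path (⟨0⟩ : AInfinity.{u}) ⟨n⟩
  | 0 => Quiver.Path.nil
  | n + 1 => (AInfinity.path n).cons ⟨⟨rfl⟩⟩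

/-- Infinitely many paths start at the first vertex, one for each target, so the piece with that
source is infinite dimensional. -/
theorem AInfinity.not_leftSemiperfect (k : Type u) [Field k] :
    ¬ LeftSemiperfect k (Subcoalgebra.full k (PathCoalgebra k AInfinity.{u})).carrier := by
  refine ((Subcoalgebra.full k
    (PathCoalgebra k AInfinity.{u})).not_leftSemiperfect_and_not_leftQuasiCoFrobenius
      (a := ⟨0⟩) fun h => ?_).1
  have hmem : ∀ n, of k (AInfinity.path.{u} n) ∈
      (Subcoalgebra.full k (PathCoalgebra k AInfinity.{u})).carrier ⊓ withSource k ⟨0⟩ := by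
    classical
    refine fun n => ⟨trivial, mem_withSource.2 fun p hp => ?_⟩
    rw [mem_support, coeffAt_of] at hp
    by_contra hne
    exact hp (if_neg (by rintro rfl; exact hne rfl))
  have hli : LinearIndependent k fun n : ℕ => of k (AInfinity.path.{u} n) := by
    have hinj : Function.Injective fun n : ℕ =>
        (⟨⟨0⟩, ⟨n⟩, AInfinity.path n⟩ : AnyPath AInfinity.{u}) := fun m n hmn =>
      congrArg (fun p : AnyPath AInfinity.{u} => p.tgt.index) hmn
    exact (Finsupp.linearIndependent_single_one k (AnyPath AInfinity.{u})).comp _ hinj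
  have hli' : LinearIndependent k fun n : ℕ => (⟨_, hmem n⟩ :
      ((Subcoalgebra.full k (PathCoalgebra k AInfinity.{u})).carrier ⊓ withSource k ⟨0⟩ :
        Submodule k (PathCoalgebra k AInfinity.{u}))) :=
    LinearIndependent.of_comp (Submodule.subtype _) hli
  exact Infinite.not_finite (α := ℕ) hli'.finite

theorem mainTheorem1 :
    (∀ (k : Type u) [Field k] (V : Type u) [Quiver.{u} V]
      (C : Subcoalgebra k (PathCoalgebra k V)),
      ¬ LeftSemiperfect k C.carrier →
        GeneratesLeftComodules k (tailClosure C).carrier ∧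
        ¬ LeftSemiperfect k (tailClosure C).carrier ∧
        ¬ LeftQuasiCoFrobenius k (tailClosure C).carrier) ∧
    (∀ (k : Type u) [Field k],
      ¬ LeftSemiperfect k
        (Subcoalgebra.full k (PathCoalgebra k AInfinity.{u})).carrier ∧
      GeneratesLeftComodules k
        (tailClosure (Subcoalgebra.full k (PathCoalgebra k AInfinity.{u}))).carrier ∧
      ¬ LeftSemiperfect k
        (tailClosure (Subcoalgebra.full k (PathCoalgebra k AInfinity.{u}))).carrier ∧
      ¬ LeftQuasiCoFrobenius k
        (tailClosure (Subcoalgebra.full k (PathCoalgebra k AInfinity.{u}))).carrier) ∧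
    (∀ (k : Type u) [Field k],
      ¬ ∀ (C : Type u) [AddCommGroup C] [Module k C] [Coalgebra k C],
        GeneratesLeftComodules k C → LeftQuasiCoFrobenius k C) := by
  have h (k : Type u) [Field k] := tailClosure_properties _ (AInfinity.not_leftSemiperfect k)
  refine ⟨fun k _ V _ C hC => tailClosure_properties C hC,
    fun k _ => ⟨AInfinity.not_leftSemiperfect k, h k⟩, fun k _ H => ?_⟩
  exact (h k).2.2 (H _ (h k).1)
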